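/- Let $\mathbb{D}$ be the open unit disk and let $H^2$ be the space of analytic functions $f$ on $\mathbb{D}$ with $\|f\|^2=\sup_{0<r<1}\int_0^{2\pi}|f(re^{i\theta})|^2\,\frac{d\theta}{2\pi}<\infty$. Let $\varphi$ be a hyperbolic automorphism of $\mathbb{D}$, that is, a holomorphic bijection of $\mathbb{D}$ onto itself whose continuous extension to $\overline{\mathbb{D}}$ has exactly two fixed points on $\partial\mathbb{D}$. Let $a\in\partial\mathbb{D}$ be its Denjoy–Wolff point (the boundary fixed point to which the iterates of $\varphi$ converge uniformly on compact subsets of $\mathbb{D}$) and $b\neq a$ its other fixed point on $\partial\mathbb{D}$. Let $\psi$ be a bounded analytic function on $\mathbb{D}$ that is continuous at $a$ and at $b$, that is, $\psi(z)$ has limits, denoted $\psi(a)$ and $\psi(b)$, as $z\to a$ and $z\to b$ within $\mathbb{D}$. Then the derivatives $\varphi'(a)$ and $\varphi'(b)$ of the extended map, taken within $\overline{\mathbb{D}}$, exist and are positive real numbers, the weighted composition operator $C_{\psi,\varphi}f=\psi\cdot(f\circ\varphi)$ is bounded on $H^2$, and, if $C_{\psi,\varphi}$ is not invertible on $H^2$,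 its spectrum on $H^2$ is $$\sigma(C_{\psi,\varphi})=\Bigl\{\lambda\in\mathbb{C} : |\lambda|\le\max\bigl\{|\psi(a)|\,\varphi'(a)^{-1/2},\ |\psi(b)|\,\varphi'(b)^{-1/2}\bigr\}\Bigr\}.$$ -/

import Mathlib

open Filter Topology Metric Set

noncomputable section

namespace HardyDisk

/-- The open unit disk. -/
abbrev disk : Set ℂ := ball (0 : ℂ) 1

/-! ### The Hardy space `H²` of the disk -/

/-- The quadratic integral mean `∫₀^{2π} |f(r e^{iθ})|² dθ / 2π` over the circle of radius `r`. -/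
def mean (f : ℂ → ℂ) (r : ℝ) : ℝ := Real.circleAverage (fun z => ‖f z‖ ^ 2) 0 r

theorem mean_nonneg (f : ℂ → ℂ) (r : ℝ) : 0 ≤ mean f r := by
  rw [mean, Real.circleAverage_def, smul_eq_mul]
  have : 0 ≤ ∫ θ in (0 : ℝ)..2 * Real.pi, ‖f (circleMap 0 r θ)‖ ^ 2 :=
    intervalIntegral.integral_nonneg (by positivity) (fun _ _ => by positivity)
  positivity

theorem circleMap_mem_disk {r : ℝ} (hr : r ∈ Ioo (0 : ℝ) 1) (θ : ℝ) :
    circleMap 0 r θ ∈ disk := by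
  simp [disk, abs_of_pos hr.1, hr.2]

theorem continuous_circle {f : ℂ → ℂ} (hf : DifferentiableOn ℂ f disk) {r : ℝ}
    (hr : r ∈ Ioo (0 : ℝ) 1) : Continuous (fun θ : ℝ => ‖f (circleMap 0 r θ)‖ ^ 2) :=
  ((hf.continuousOn.comp_continuous (continuous_circleMap 0 r)
    (circleMap_mem_disk hr)).norm).pow 2

theorem mean_add_le {f g : ℂ → ℂ} (hf : DifferentiableOn ℂ f disk)
    (hg : DifferentiableOn ℂ g disk) {r : ℝ} (hr : r ∈ Ioo (0 : ℝ) 1) {x y : ℝ}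
    (hx : 0 < x) (hy : 0 < y) :
    mean (f + g) r ≤ (x + y) * (mean f r / x + mean g r / y) := by
  have hF := continuous_circle hf hr
  have hG := continuous_circle hg hr
  have hS := continuous_circle (hf.add hg) hr
  have hpi : 0 ≤ (2 * Real.pi)⁻¹ := by positivity
  simp only [mean, Real.circleAverage_def, smul_eq_mul]
  have key : ∫ θ in (0 : ℝ)..2 * Real.pi, ‖(f + g) (circleMap 0 r θ)‖ ^ 2 ≤
      ∫ θ in (0 : ℝ)..2 * Real.pi, ((x + y) / x * ‖f (circleMap 0 r θ)‖ ^ 2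
        + (x + y) / y * ‖g (circleMap 0 r θ)‖ ^ 2) := by
    apply intervalIntegral.integral_mono_on (by positivity)
    · exact hS.intervalIntegrable _ _
    · exact ((hF.const_mul _).add (hG.const_mul _)).intervalIntegrable _ _
    · intro θ _
      have h1 := norm_add_le (f (circleMap 0 r θ)) (g (circleMap 0 r θ))
      have h2 := norm_nonneg (f (circleMap 0 r θ) + g (circleMap 0 r θ))
      simp only [Pi.add_apply]
      set p := ‖f (circleMap 0 r θ)‖
      set q := ‖g (circleMap 0 r θ)‖
      have h3 : ‖f (circleMap 0 r θ) + g (circleMap 0 r θ)‖ ^ 2 ≤ (p + q) ^ 2 := by gcongr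
      have h4 : (x + y) / x * p ^ 2 + (x + y) / y * q ^ 2 - (p + q) ^ 2
          = (y * p - x * q) ^ 2 / (x * y) := by
        field_simp
        ring
      have h5 : 0 ≤ (y * p - x * q) ^ 2 / (x * y) := by positivity
      linarith
  rw [intervalIntegral.integral_add ((hF.const_mul _).intervalIntegrable _ _)
    ((hG.const_mul _).intervalIntegrable _ _), intervalIntegral.integral_const_mul,
    intervalIntegral.integral_const_mul] at key
  calc _ ≤ (2 * Real.pi)⁻¹ * _ := mul_le_mul_of_nonneg_left key hpi
    _ = _ := by ring

theorem mean_smul (c : ℂ) (f : ℂ → ℂ) (r : ℝ) : mean (c • f) r = ‖c‖ ^ 2 * mean f r := by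
  simp only [mean, Real.circleAverage_def, smul_eq_mul, Pi.smul_apply, norm_mul, mul_pow,
    intervalIntegral.integral_const_mul]
  ring

/-- The square of the `H²` norm, `sup_{0<r<1} ∫₀^{2π} |f(r e^{iθ})|² dθ / 2π`
(meaningful when the integral means are bounded). -/
def normSq (f : ℂ → ℂ) : ℝ := sSup (mean f '' Ioo (0 : ℝ) 1)

/-- The functions of `H²`: analytic in the disk, with bounded quadratic integral means.
A function on the disk is represented by its extension by `0` to the plane, so that two elements
are equal exactly when they agree on the disk. -/
def hardySubmodule : Submodule ℂ (ℂ → ℂ) where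
  carrier := {f | DifferentiableOn ℂ f disk ∧ BddAbove (mean f '' Ioo (0 : ℝ) 1) ∧
    ∀ z, z ∉ disk → f z = 0}
  zero_mem' := by
    refine ⟨differentiableOn_const 0, ⟨0, ?_⟩, fun _ _ => rfl⟩
    rintro _ ⟨r, _, rfl⟩
    simp [mean, Real.circleAverage_def]
  add_mem' := by
    rintro f g ⟨hf, ⟨A, hA⟩, hf0⟩ ⟨hg, ⟨B, hB⟩, hg0⟩
    refine ⟨hf.add hg, ⟨2 * (A + B), ?_⟩, fun z hz => by simp [hf0 z hz, hg0 z hz]⟩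
    rintro _ ⟨r, hr, rfl⟩
    have h := mean_add_le hf hg hr one_pos one_pos
    have h1 := hA (mem_image_of_mem _ hr)
    have h2 := hB (mem_image_of_mem _ hr)
    linarith
  smul_mem' := by
    rintro c f ⟨hf, ⟨A, hA⟩, hf0⟩
    refine ⟨hf.const_smul c, ⟨‖c‖ ^ 2 * A, ?_⟩, fun z hz => by simp [hf0 z hz]⟩
    rintro _ ⟨r, hr, rfl⟩
    rw [mean_smul]
    exact mul_le_mul_of_nonneg_left (hA (mem_image_of_mem _ hr)) (by positivity)

/-- The Hardy space `H²` of the disk (a separate type, so that its only topology is the one of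
the norm below). -/
def H2 : Type := hardySubmodule

namespace H2

instance : AddCommGroup H2 := inferInstanceAs (AddCommGroup hardySubmodule)

instance : Module ℂ H2 := inferInstanceAs (Module ℂ hardySubmodule)

/-- The underlying function of an element of `H²`. -/
def toFun (f : H2) : ℂ → ℂ := f.1

instance : CoeFun H2 (fun _ => ℂ → ℂ) := ⟨toFun⟩

/-- `‖f‖² = sup_{0<r<1} ∫₀^{2π} |f(r e^{iθ})|² dθ / 2π`. -/
instance : Norm H2 := ⟨fun f => √(normSq f)⟩

theorem norm_def (f : H2) : ‖f‖ = √(normSq f) := rfl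

theorem mean_le (f : H2) {r : ℝ} (hr : r ∈ Ioo (0 : ℝ) 1) : mean f r ≤ ‖f‖ ^ 2 := by
  have h : mean f r ≤ normSq f := le_csSup f.2.2.1 (mem_image_of_mem _ hr)
  rw [norm_def, Real.sq_sqrt ((mean_nonneg f r).trans h)]
  exact h

theorem norm_le (f : H2) {C : ℝ} (hC : 0 ≤ C)
    (h : ∀ r ∈ Ioo (0 : ℝ) 1, mean f r ≤ C ^ 2) : ‖f‖ ≤ C := by
  rw [norm_def]
  refine Real.sqrt_le_iff.2 ⟨hC, csSup_le ?_ ?_⟩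
  · exact ⟨_, mem_image_of_mem _ (show (1 / 2 : ℝ) ∈ Ioo (0 : ℝ) 1 by norm_num)⟩
  · rintro _ ⟨r, hr, rfl⟩
    exact h r hr

theorem norm_nn (f : H2) : 0 ≤ ‖f‖ := Real.sqrt_nonneg _

theorem norm_smul_le' (c : ℂ) (f : H2) : ‖c • f‖ ≤ ‖c‖ * ‖f‖ := by
  refine norm_le _ (mul_nonneg (norm_nonneg c) (norm_nn f)) fun r hr => ?_
  have : mean (c • f : H2) r = ‖c‖ ^ 2 * mean f r := mean_smul c f r
  rw [this, mul_pow]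
  exact mul_le_mul_of_nonneg_left (mean_le f hr) (by positivity)

theorem norm_zero' : ‖(0 : H2)‖ = 0 := by
  refine le_antisymm (norm_le _ le_rfl fun r _ => ?_) (norm_nn _)
  have : ((0 : H2) : ℂ → ℂ) = 0 := rfl
  simp [this, mean, Real.circleAverage_def]

theorem core : NormedSpace.Core ℂ H2 where
  norm_nonneg := norm_nn
  norm_smul c f := by
    refine le_antisymm (norm_smul_le' c f) ?_
    rcases eq_or_ne c 0 with rfl | hc
    · simpa using norm_nn _
    · have h := norm_smul_le' c⁻¹ (c • f)
      rw [inv_smul_smul₀ hc, norm_inv] at h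
      have hc' : 0 < ‖c‖ := norm_pos_iff.2 hc
      calc ‖c‖ * ‖f‖ ≤ ‖c‖ * (‖c‖⁻¹ * ‖c • f‖) := mul_le_mul_of_nonneg_left h hc'.le
        _ = ‖c • f‖ := by field_simp
  norm_triangle f g := by
    refine le_of_forall_pos_le_add fun ε hε => ?_
    have hf := norm_nn f
    have hg := norm_nn g
    refine norm_le _ (by positivity) fun r hr => ?_
    have hx : 0 < ‖f‖ + ε / 2 := by positivity
    have hy : 0 < ‖g‖ + ε / 2 := by positivity
    have h : mean (f + g : H2) r ≤ _ := mean_add_le f.2.1 g.2.1 hr hx hy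
    have h1 : mean f r / (‖f‖ + ε / 2) ≤ ‖f‖ + ε / 2 := by
      rw [div_le_iff₀ hx]
      nlinarith [mean_le f hr]
    have h2 : mean g r / (‖g‖ + ε / 2) ≤ ‖g‖ + ε / 2 := by
      rw [div_le_iff₀ hy]
      nlinarith [mean_le g hr]
    calc mean (f + g : H2) r ≤ _ := h
      _ ≤ (‖f‖ + ε / 2 + (‖g‖ + ε / 2)) * (‖f‖ + ε / 2 + (‖g‖ + ε / 2)) := by
        gcongr
        exact h1
        exact h2
      _ = _ := by ring
  norm_eq_zero_iff f := by
    constructor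
    · intro h0
      have hpos : ∀ z ∈ disk, z ≠ 0 → f z = 0 := by
        intro z hz hz0
        have hr : ‖z‖ ∈ Ioo (0 : ℝ) 1 := ⟨norm_pos_iff.2 hz0, by simpa [disk] using hz⟩
        have hm : mean f ‖z‖ = 0 :=
          le_antisymm (by simpa [h0] using mean_le f hr) (mean_nonneg _ _)
        by_contra hne
        have hcont := continuous_circle f.2.1 hr
        have hlt : 0 < ∫ θ in z.arg..z.arg + 2 * Real.pi, ‖f (circleMap 0 ‖z‖ θ)‖ ^ 2 := by
          refine intervalIntegral.integral_pos (by linarith [Real.pi_pos]) hcont.continuousOn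
            (fun _ _ => by positivity)
            ⟨z.arg, ⟨le_rfl, by linarith [Real.pi_pos]⟩, ?_⟩
          have : circleMap 0 ‖z‖ z.arg = z := by simp [circleMap]
          rw [this]
          positivity
        have hper : Function.Periodic (fun θ : ℝ => ‖f (circleMap 0 ‖z‖ θ)‖ ^ 2)
            (2 * Real.pi) := fun θ => by
          simp only [periodic_circleMap 0 ‖z‖ θ]
        rw [hper.intervalIntegral_add_eq z.arg 0, zero_add] at hlt
        rw [mean, Real.circleAverage_def, smul_eq_mul] at hm
        have : 0 < (2 * Real.pi)⁻¹ := by positivity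
        exact (mul_pos this hlt).ne' hm
      have hzero : f 0 = 0 := by
        have hc : ContinuousAt f 0 :=
          (f.2.1.differentiableAt (ball_mem_nhds 0 one_pos)).continuousAt
        have h1 : Tendsto f (𝓝[≠] 0) (𝓝 (f 0)) := hc.tendsto.mono_left nhdsWithin_le_nhds
        have h2 : Tendsto f (𝓝[≠] 0) (𝓝 0) := by
          refine tendsto_const_nhds.congr' ?_
          filter_upwards [self_mem_nhdsWithin,
            mem_nhdsWithin_of_mem_nhds (ball_mem_nhds (0 : ℂ) one_pos)] with z hz hz'
          exact (hpos z hz' hz).symm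
        exact tendsto_nhds_unique h1 h2
      apply Subtype.ext
      funext z
      change f z = 0
      by_cases hz : z ∈ disk
      · rcases eq_or_ne z 0 with rfl | hz0
        · exact hzero
        · exact hpos z hz hz0
      · exact f.2.2.2 z hz
    · rintro rfl
      exact norm_zero'

instance : NormedAddCommGroup H2 := NormedAddCommGroup.ofCore core

instance : NormedSpace ℂ H2 := NormedSpace.ofCore core

end H2

/-! ### Automorphisms of the disk -/

/-- An automorphism of the disk: a holomorphic bijection of the disk onto itself
(only the values of `φ` on the disk matter). -/
def IsAutomorphism (φ : ℂ → ℂ) : Prop :=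
  DifferentiableOn ℂ φ disk ∧ BijOn φ disk disk

/-- The extension of an automorphism to the closed disk by limits from inside. -/
def boundaryExt (φ : ℂ → ℂ) : ℂ → ℂ := extendFrom disk φ

/-- The set of fixed points of `φ` on the unit circle. -/
def boundaryFixedPoints (φ : ℂ → ℂ) : Set ℂ :=
  {ζ | ζ ∈ sphere (0 : ℂ) 1 ∧ boundaryExt φ ζ = ζ}

/-- Hyperbolic automorphism: there are exactly two fixed points on the unit circle. (The identity,
which fixes the whole circle, is thereby excluded.) -/
def IsHyperbolic (φ : ℂ → ℂ) : Prop :=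
  IsAutomorphism φ ∧ (boundaryFixedPoints φ).ncard = 2

/-- `a` is the Denjoy-Wolff point of the (hyperbolic or parabolic) automorphism `φ`: the boundary
fixed point to which the iterates of `φ` converge uniformly on compact subsets of the disk. -/
def IsDenjoyWolffPoint (φ : ℂ → ℂ) (a : ℂ) : Prop :=
  a ∈ boundaryFixedPoints φ ∧
    ∀ K ⊆ disk, IsCompact K → TendstoUniformlyOn (fun n => φ^[n]) (fun _ => a) atTop K

/-! ### Symbols and operators -/

/-- `ψ` is a bounded analytic function on the disk. -/
def IsHInfty (ψ : ℂ → ℂ) : Prop :=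
  DifferentiableOn ℂ ψ disk ∧ ∃ M : ℝ, ∀ z ∈ disk, ‖ψ z‖ ≤ M

/-- `T` is the weighted composition operator `f ↦ ψ · (f ∘ φ)` on `H²`. -/
def IsWeightedComposition (ψ φ : ℂ → ℂ) (T : H2 →L[ℂ] H2) : Prop :=
  ∀ f : H2, ∀ z ∈ disk, T f z = ψ z * f (φ z)

end HardyDisk

end

/-!
The idea is to factor the operator through an isometric dilation. A disk automorphism `φ` is a
Möbius map `mob c p` (`IsAutomorphism.exists_mob`), and `U f = kern p · (f ∘ φ)`, where
`|kern p|² = |φ'|`, is a contraction of `H²` (`exists_kern_mul_comp_mob`, by Poisson integrals).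
Hence `C_{ψ,φ} = Ψ U` with `Ψ = ψ / kern p`, and `|Ψ|` has the limits `A = |ψ(a)| φ'(a)^{-1/2}` and
`B = |ψ(b)| φ'(b)^{-1/2}` at `a` and `b`. In the half-plane coordinate `Q = halfPlane a b`, the map
`φ` is the dilation by a number `μ = φ'(b) = 1 / φ'(a) > 1` (`halfPlane_mob`), so an orbit spends a
bounded time away from `a` and `b`.

* *Upper bound* (`norm_le_of_mem_spectrum`). For `ρ > max A B`, a truncated power `v` of `|Q|`
  satisfies `|Ψ| v ≤ ρ (v ∘ φ)`; as `U` is a contraction, `‖T ^ n‖ ≤ C ρ ^ n`.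
* *Twisting* (`exists_twist`). The bounded functions `Q ^ (i t)` satisfy
  `Q(φ(z)) ^ (i t) = μ ^ (i t) Q(z) ^ (i t)`. Applying an orbit series for the resolvent to functions
  multiplied by them rotates the `n`-th term by `μ ^ (i t n)`; averaging over `t`, each single term
  is bounded by the norm of the resolvent (`norm_coeff_le`).
* *The disk `|l| < B`* (`mem_spectrum_of_norm_lt`). If `l - T` is invertible, the solution of
  `(l - T) f = g` gives a series along backward orbits whose first term, for `g` a reproducing
  kernel, shows that `|Ψ|` is bounded below; then `T` is invertible.
* *The annulus `B < |l| < A`* (`mem_spectrum_of_norm_mem_Ioo`). On functions vanishing to high order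
  at `a` the inverse of `l - T` would be the Neumann series; its terms being bounded,
  `‖T ^ n‖` would grow at most like `|l| ^ n`, whereas kernels along an orbit tending to `a` show
  growth `ρ ^ n` for every `ρ < A`.

Since the spectrum is closed, these inclusions determine it.
-/

open scoped ComplexConjugate

namespace HardyDisk

theorem H2.ext {f g : H2} (h : ∀ z ∈ disk, f z = g z) : f = g := by
  apply Subtype.ext
  funext z
  by_cases hz : z ∈ disk
  · exact h z hz
  · exact (f.2.2.2 z hz).trans (g.2.2.2 z hz).symm

theorem H2.differentiableOn (f : H2) : DifferentiableOn ℂ f disk := f.2.1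

@[simp] theorem H2.add_apply (f g : H2) (z : ℂ) : (f + g) z = f z + g z := rfl

@[simp] theorem H2.smul_apply (c : ℂ) (f : H2) (z : ℂ) : (c • f) z = c * f z := rfl

@[simp] theorem H2.sub_apply (f g : H2) (z : ℂ) : (f - g) z = f z - g z := rfl

theorem continuousOn_sphere {f : ℂ → ℂ} (hf : DifferentiableOn ℂ f disk) {r : ℝ}
    (hr : r ∈ Ioo (0 : ℝ) 1) : ContinuousOn f (sphere 0 |r|) :=
  hf.continuousOn.mono fun z hz => by
    simp only [mem_sphere, dist_zero_right, abs_of_pos hr.1] at hz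
    simp [hz, hr.2]

theorem circleIntegrable_norm_sq {f : ℂ → ℂ} (hf : DifferentiableOn ℂ f disk) {r : ℝ}
    (hr : r ∈ Ioo (0 : ℝ) 1) : CircleIntegrable (fun z => ‖f z‖ ^ 2) 0 r :=
  ((continuousOn_sphere hf hr).norm.pow 2).circleIntegrable'

theorem mean_mono {f g : ℂ → ℂ} (hf : DifferentiableOn ℂ f disk)
    (hg : DifferentiableOn ℂ g disk) {r : ℝ} (hr : r ∈ Ioo (0 : ℝ) 1) {c : ℝ}
    (h : ∀ z ∈ disk, ‖f z‖ ≤ c * ‖g z‖) : mean f r ≤ c ^ 2 * mean g r := by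
  have hi := (circleIntegrable_norm_sq hg hr).const_fun_smul (a := c ^ 2)
  have : mean f r ≤ Real.circleAverage (fun z => (c ^ 2) • ‖g z‖ ^ 2) 0 r := by
    refine Real.circleAverage_mono (circleIntegrable_norm_sq hf hr) hi fun z hz => ?_
    have hz' : z ∈ disk := by
      simp only [mem_sphere, dist_zero_right, abs_of_pos hr.1] at hz
      simp [hz, hr.2]
    have := h z hz'
    rw [smul_eq_mul, ← mul_pow]
    gcongr
  rwa [Real.circleAverage_fun_smul, smul_eq_mul] at this

theorem mean_congr {f g : ℂ → ℂ} {r : ℝ} (hr : r ∈ Ioo (0 : ℝ) 1)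
    (h : ∀ z ∈ disk, f z = g z) : mean f r = mean g r := by
  refine Real.circleAverage_congr_sphere fun z hz => ?_
  simp only [mem_sphere, dist_zero_right, abs_of_pos hr.1] at hz
  simp only [h z (by simp [hz, hr.2])]

/-- A holomorphic function on the disk with quadratic means bounded by `C ^ 2` determines an element
of `H²` of norm at most `C`. -/
theorem exists_H2 {f : ℂ → ℂ} (hf : DifferentiableOn ℂ f disk) {C : ℝ} (hC : 0 ≤ C)
    (h : ∀ r ∈ Ioo (0 : ℝ) 1, mean f r ≤ C ^ 2) :
    ∃ F : H2, (∀ z ∈ disk, F z = f z) ∧ ‖F‖ ≤ C := by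
  have heq : ∀ z ∈ disk, disk.indicator f z = f z := fun z hz => indicator_of_mem hz f
  have hm : ∀ r ∈ Ioo (0 : ℝ) 1, mean (disk.indicator f) r ≤ C ^ 2 := fun r hr =>
    (mean_congr hr heq).trans_le (h r hr)
  refine ⟨⟨disk.indicator f, hf.congr heq, ⟨C ^ 2, ?_⟩, fun z hz => indicator_of_notMem hz f⟩,
    heq, H2.norm_le _ hC hm⟩
  rintro _ ⟨r, hr, rfl⟩
  exact hm r hr

theorem exists_mul {g : ℂ → ℂ} (hg : DifferentiableOn ℂ g disk) {M : ℝ} (hM : 0 ≤ M)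
    (h : ∀ z ∈ disk, ‖g z‖ ≤ M) (f : H2) :
    ∃ F : H2, (∀ z ∈ disk, F z = g z * f z) ∧ ‖F‖ ≤ M * ‖f‖ := by
  refine exists_H2 (hg.mul f.differentiableOn) (mul_nonneg hM (norm_nonneg f)) fun r hr => ?_
  rw [mul_pow]
  refine (mean_mono (hg.mul f.differentiableOn) f.differentiableOn hr (c := M) fun z hz => ?_).trans
    (mul_le_mul_of_nonneg_left (H2.mean_le f hr) (by positivity))
  simp only [Pi.mul_apply, norm_mul]
  gcongr
  exact h z hz

theorem H2.norm_le_of_pointwise {f g : H2} {c : ℝ} (hc : 0 ≤ c)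
    (h : ∀ z ∈ disk, ‖f z‖ ≤ c * ‖g z‖) : ‖f‖ ≤ c * ‖g‖ := by
  refine H2.norm_le _ (mul_nonneg hc (norm_nonneg g)) fun r hr => ?_
  rw [mul_pow]
  exact (mean_mono f.differentiableOn g.differentiableOn hr h).trans
    (mul_le_mul_of_nonneg_left (H2.mean_le g hr) (by positivity))

/-- A pointwise defined weighted composition that is norm bounded on `H²` is a continuous linear
operator. -/
theorem exists_clm {w φ : ℂ → ℂ} {C : ℝ}
    (h : ∀ f : H2, ∃ F : H2, (∀ z ∈ disk, F z = w z * f (φ z)) ∧ ‖F‖ ≤ C * ‖f‖) :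
    ∃ T : H2 →L[ℂ] H2, ∀ f : H2, (∀ z ∈ disk, T f z = w z * f (φ z)) ∧ ‖T f‖ ≤ C * ‖f‖ := by
  choose S hS hS' using h
  refine ⟨LinearMap.mkContinuous ⟨⟨S, fun f g => ?_⟩, fun c f => ?_⟩ C hS', fun f =>
    ⟨hS f, hS' f⟩⟩
  · refine H2.ext fun z hz => ?_
    simp only [H2.add_apply, hS _ z hz]
    ring
  · refine H2.ext fun z hz => ?_
    simp only [RingHom.id_apply, H2.smul_apply, hS _ z hz]
    ring

/-! ### Poisson integrals and integral means -/

theorem poissonKernel_nonneg {s : ℝ} {p z : ℂ} (hp : ‖p‖ ≤ s) (hz : ‖z‖ = s) :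
    0 ≤ poissonKernel 0 p z := by
  rw [poissonKernel_def]
  simp only [sub_zero, hz]
  have : ‖p‖ ^ 2 ≤ s ^ 2 := by gcongr
  exact div_nonneg (by linarith) (by positivity)

theorem poissonKernel_continuousOn {s : ℝ} (hs : 0 < s) {p : ℂ} (hp : ‖p‖ < s) :
    ContinuousOn (poissonKernel 0 p) (sphere 0 |s|) := by
  have : ∀ z ∈ sphere (0 : ℂ) |s|, ‖(z - 0) - (p - 0)‖ ^ 2 ≠ 0 := by
    intro z hz
    simp only [mem_sphere, dist_zero_right, abs_of_pos hs] at hz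
    have : z - p ≠ 0 := by
      intro h
      rw [sub_eq_zero.1 h] at hz
      linarith
    simpa using this
  unfold poissonKernel
  fun_prop (disch := assumption)

/-- The Poisson integral of `|f|²` over the circle of radius `r` is a majorant of `|f|²` inside. -/
theorem norm_sq_le_poisson {f : ℂ → ℂ} (hf : DifferentiableOn ℂ f disk) {r : ℝ}
    (hr : r ∈ Ioo (0 : ℝ) 1) {w : ℂ} (hw : w ∈ ball (0 : ℂ) r) :
    ‖f w‖ ^ 2 ≤ Real.circleAverage (poissonKernel 0 w • fun z => ‖f z‖ ^ 2) 0 r := by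
  have hd : DiffContOnCl ℂ (fun z => f z ^ 2) (ball 0 r) := by
    apply DifferentiableOn.diffContOnCl
    rw [closure_ball 0 hr.1.ne']
    exact (hf.pow 2).mono (closedBall_subset_ball hr.2)
  have h := hd.circleAverage_poissonKernel_smul hw
  rw [← norm_pow, ← h, Real.circleAverage_def, Real.circleAverage_def, norm_smul, smul_eq_mul,
    Real.norm_of_nonneg (by positivity)]
  gcongr
  refine (intervalIntegral.norm_integral_le_integral_norm (by positivity)).trans_eq ?_
  refine intervalIntegral.integral_congr fun θ _ => ?_
  simp only [Pi.smul_apply', norm_smul, norm_pow, smul_eq_mul]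
  rw [Real.norm_of_nonneg]
  exact poissonKernel_nonneg (mem_ball_zero_iff.1 hw).le (by simp [abs_of_pos hr.1])

/-- The subordination principle: the harmonic majorant of `|f|²` pulled back by a holomorphic map
vanishing at `p` has Poisson average at `p` equal to a quadratic mean of `f`. -/
theorem poisson_comp_le_mean {f χ : ℂ → ℂ} (hf : DifferentiableOn ℂ f disk)
    (hχ : DifferentiableOn ℂ χ disk) {r s : ℝ} (hr : r ∈ Ioo (0 : ℝ) 1) (hs : s ∈ Ioo (0 : ℝ) 1)
    (hmap : MapsTo χ (closedBall 0 s) (ball 0 r)) {p : ℂ} (hp : p ∈ ball (0 : ℂ) s)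
    (hχp : χ p = 0) :
    Real.circleAverage (poissonKernel 0 p • fun z => ‖f (χ z)‖ ^ 2) 0 s ≤ mean f r := by
  have hfi := circleIntegrable_norm_sq hf hr
  have hfi' : CircleIntegrable (fun z => ((‖f z‖ ^ 2 : ℝ) : ℂ)) 0 r :=
    (Complex.continuous_ofReal.comp_continuousOn
      ((continuousOn_sphere hf hr).norm.pow 2)).circleIntegrable'
  set H : ℂ → ℂ := fun w => Real.circleAverage
    (fun ζ => herglotzRieszKernel 0 w ζ • ((‖f ζ‖ ^ 2 : ℝ) : ℂ)) 0 r with hH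
  have hHd : DifferentiableOn ℂ H (ball 0 r) :=
    differentiableOn_circleAverage_herglotzRieszKernel_smul hfi'
  have hHre : ∀ w ∈ ball (0 : ℂ) r, ‖f w‖ ^ 2 ≤ (H w).re := by
    intro w hw
    rw [hH, re_circleAverage_herglotzRieszKernel_smul hfi hw,
      ← poissonKernel_eq_re_herglotzRieszKernel]
    exact norm_sq_le_poisson hf hr hw
  have hH0 : (H 0).re = mean f r := by
    rw [hH, re_circleAverage_herglotzRieszKernel_smul hfi (mem_ball_self hr.1)]
    refine Real.circleAverage_congr_sphere fun z hz => ?_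
    have hz0 : z ≠ 0 := by
      rintro rfl
      simp [abs_of_pos hr.1, hr.1.ne] at hz
    simp [herglotzRieszKernel_def, div_self hz0]
  have hcd : closedBall (0 : ℂ) s ⊆ disk := closedBall_subset_ball hs.2
  have hHχ : DifferentiableOn ℂ (H ∘ χ) (closedBall 0 s) :=
    hHd.comp (hχ.mono hcd) hmap
  have hpk := poissonKernel_continuousOn hs.1 (mem_ball_zero_iff.1 hp)
  have hsph : sphere (0 : ℂ) |s| ⊆ closedBall 0 s := by
    rw [abs_of_pos hs.1]
    exact sphere_subset_closedBall
  have hfχ : DifferentiableOn ℂ (f ∘ χ) (closedBall 0 s) :=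
    hf.comp (hχ.mono hcd) fun z hz => ball_subset_ball hr.2.le (hmap hz)
  have hci : CircleIntegrable (poissonKernel 0 p • (H ∘ χ)) 0 s :=
    (hpk.smul (hHχ.continuousOn.mono hsph)).circleIntegrable'
  have hre := Complex.reCLM.circleAverage_comp_comm hci
  have hHχ' : DiffContOnCl ℂ (H ∘ χ) (ball 0 s) := by
    apply DifferentiableOn.diffContOnCl
    rwa [closure_ball 0 hs.1.ne']
  rw [hHχ'.circleAverage_poissonKernel_smul hp, Function.comp_apply, hχp, Complex.reCLM_apply,
    hH0] at hre
  rw [← hre]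
  refine Real.circleAverage_mono ?_ ?_ fun z hz => ?_
  · exact (hpk.smul ((hfχ.continuousOn.mono hsph).norm.pow 2)).circleIntegrable'
  · exact (Complex.continuous_re.comp_continuousOn
      (hpk.smul (hHχ.continuousOn.mono hsph))).circleIntegrable'
  · simp only [Pi.smul_apply', smul_eq_mul, Function.comp_apply, Complex.reCLM_apply,
      Complex.real_smul, Complex.re_ofReal_mul]
    refine mul_le_mul_of_nonneg_left (hHre _ (hmap (hsph hz))) (poissonKernel_nonneg
      (mem_ball_zero_iff.1 hp).le ?_)
    simpa [abs_of_pos hs.1] using hz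

theorem mean_monotone {f : ℂ → ℂ} (hf : DifferentiableOn ℂ f disk) {s r : ℝ}
    (hs : s ∈ Ioo (0 : ℝ) 1) (hr : r ∈ Ioo (0 : ℝ) 1) (hsr : s < r) : mean f s ≤ mean f r := by
  have h := poisson_comp_le_mean hf differentiableOn_id hr hs
    (fun z hz => closedBall_subset_ball hsr hz) (mem_ball_self hs.1) rfl
  refine le_of_eq_of_le (Real.circleAverage_congr_sphere fun z hz => ?_) h
  have hz' : ‖z‖ = s := by simpa [abs_of_pos hs.1] using hz
  simp [poissonKernel_def, hz', hs.1.ne']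

theorem norm_apply_zero_le (f : H2) : ‖f 0‖ ≤ ‖f‖ := by
  have hr : (1 / 2 : ℝ) ∈ Ioo (0 : ℝ) 1 := by norm_num
  have h := norm_sq_le_poisson f.differentiableOn hr (mem_ball_self hr.1)
  have h2 : Real.circleAverage (poissonKernel 0 0 • fun z => ‖f z‖ ^ 2) 0 (1 / 2)
      = mean f (1 / 2) := by
    refine Real.circleAverage_congr_sphere fun z hz => ?_
    have hz' : ‖z‖ = 1 / 2 := by simpa [abs_of_pos hr.1] using hz
    simp [poissonKernel_def, hz']
  rw [h2] at h
  exact le_of_sq_le_sq (h.trans (H2.mean_le f hr)) (norm_nonneg f)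

/-! ### Möbius automorphisms of the disk and the contraction they induce on `H²` -/

/-- The disk automorphism `z ↦ c (z - p) / (1 - p̄ z)` (for `‖c‖ = 1`, `‖p‖ < 1`). -/
noncomputable def mob (c p z : ℂ) : ℂ := c * (z - p) / (1 - conj p * z)

/-- A holomorphic square root of the derivative of `mob c p`, up to a unimodular constant; it is
the normalized reproducing kernel of `H²` at `p`. -/
noncomputable def kern (p z : ℂ) : ℂ := (√(1 - ‖p‖ ^ 2) : ℝ) / (1 - conj p * z)

section Mobius
variable {c p z : ℂ}

theorem one_sub_conj_mul_ne_zero (hp : ‖p‖ < 1) (hz : ‖z‖ ≤ 1) : 1 - conj p * z ≠ 0 := by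
  intro h
  have h1 : ‖conj p * z‖ = 1 := by rw [← sub_eq_zero.1 h, norm_one]
  rw [norm_mul, RCLike.norm_conj] at h1
  nlinarith [norm_nonneg p, norm_nonneg z]

theorem norm_sq_one_sub_conj_mul (p z : ℂ) :
    ‖1 - conj p * z‖ ^ 2 - ‖z - p‖ ^ 2 = (1 - ‖p‖ ^ 2) * (1 - ‖z‖ ^ 2) := by
  simp only [← Complex.normSq_eq_norm_sq, Complex.normSq_apply, Complex.sub_re, Complex.sub_im,
    Complex.mul_re, Complex.mul_im, Complex.conj_re, Complex.conj_im, Complex.one_re,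
    Complex.one_im]
  ring

theorem one_sub_norm_mob_sq (hc : ‖c‖ = 1) (hp : ‖p‖ < 1) (hz : ‖z‖ ≤ 1) :
    1 - ‖mob c p z‖ ^ 2 = (1 - ‖p‖ ^ 2) * (1 - ‖z‖ ^ 2) / ‖1 - conj p * z‖ ^ 2 := by
  have h := norm_pos_iff.2 (one_sub_conj_mul_ne_zero hp hz)
  rw [mob, norm_div, norm_mul, hc, one_mul, ← norm_sq_one_sub_conj_mul, div_pow, sub_div,
    div_self (pow_ne_zero 2 h.ne')]

theorem norm_kern_sq (hp : ‖p‖ < 1) (z : ℂ) :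
    ‖kern p z‖ ^ 2 = (1 - ‖p‖ ^ 2) / ‖1 - conj p * z‖ ^ 2 := by
  have : 0 ≤ 1 - ‖p‖ ^ 2 := by nlinarith [norm_nonneg p]
  rw [kern, norm_div, div_pow, Complex.norm_real, Real.norm_of_nonneg (Real.sqrt_nonneg _),
    Real.sq_sqrt this]

/-- The equality case of the Schwarz-Pick inequality. -/
theorem norm_kern_sq_mul (hc : ‖c‖ = 1) (hp : ‖p‖ < 1) (hz : ‖z‖ ≤ 1) :
    ‖kern p z‖ ^ 2 * (1 - ‖z‖ ^ 2) = 1 - ‖mob c p z‖ ^ 2 := by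
  rw [one_sub_norm_mob_sq hc hp hz, norm_kern_sq hp]
  ring

theorem kern_ne_zero (hp : ‖p‖ < 1) (hz : ‖z‖ ≤ 1) : kern p z ≠ 0 := by
  have : 0 < 1 - ‖p‖ ^ 2 := by nlinarith [norm_nonneg p]
  exact div_ne_zero (by simpa using (Real.sqrt_pos.2 this).ne') (one_sub_conj_mul_ne_zero hp hz)

theorem mob_mem_disk (hc : ‖c‖ = 1) (hp : ‖p‖ < 1) (hz : z ∈ disk) : mob c p z ∈ disk := by
  have hz' : ‖z‖ < 1 := mem_ball_zero_iff.1 hz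
  have h := one_sub_norm_mob_sq hc hp hz'.le
  have h2 := norm_pos_iff.2 (one_sub_conj_mul_ne_zero hp hz'.le)
  have h3 : 0 < 1 - ‖p‖ ^ 2 := by nlinarith [norm_nonneg p]
  have h4 : 0 < 1 - ‖z‖ ^ 2 := by nlinarith [norm_nonneg z]
  have : 0 < 1 - ‖mob c p z‖ ^ 2 := by rw [h]; positivity
  refine mem_ball_zero_iff.2 ?_
  nlinarith [norm_nonneg (mob c p z)]

theorem mob_self : mob c p p = 0 := by simp [mob]

theorem mob_mob_inv (hc : ‖c‖ = 1) (hp : ‖p‖ < 1) (hz : z ∈ disk) :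
    mob (conj c) (-(c * p)) (mob c p z) = z := by
  have hz' : ‖z‖ < 1 := mem_ball_zero_iff.1 hz
  have h1 := one_sub_conj_mul_ne_zero hp hz'.le
  have hcc : conj c * c = 1 := by
    rw [mul_comm, Complex.mul_conj, Complex.normSq_eq_norm_sq, hc]; simp
  have h2 : 1 - conj (-(c * p)) * mob c p z
      = (1 - conj p * p) / (1 - conj p * z) := by
    rw [mob, eq_div_iff h1, sub_mul, mul_assoc _ _ (1 - conj p * z), div_mul_cancel₀ _ h1]
    simp only [map_neg, map_mul]
    linear_combination (conj p * (z - p)) * hcc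
  have h3 : conj c * (mob c p z - -(c * p)) = z * (1 - conj p * p) / (1 - conj p * z) := by
    rw [mob, eq_div_iff h1, sub_neg_eq_add, mul_assoc, add_mul, div_mul_cancel₀ _ h1]
    linear_combination (z - p + p * (1 - conj p * z)) * hcc
  have h4 : 1 - conj p * p ≠ 0 := one_sub_conj_mul_ne_zero hp hp.le
  rw [mob, h2, h3, div_div_div_cancel_right₀ h1, mul_div_cancel_right₀ _ h4]

theorem differentiableOn_one_sub : DifferentiableOn ℂ (fun z => 1 - conj p * z) disk := by
  fun_prop

theorem differentiableOn_mob (hp : ‖p‖ < 1) : DifferentiableOn ℂ (mob c p) disk := by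
  refine DifferentiableOn.div (by fun_prop) differentiableOn_one_sub fun z hz =>
    one_sub_conj_mul_ne_zero hp (mem_ball_zero_iff.1 hz).le

theorem differentiableOn_kern (hp : ‖p‖ < 1) : DifferentiableOn ℂ (kern p) disk := by
  refine DifferentiableOn.div (by fun_prop) differentiableOn_one_sub fun z hz =>
    one_sub_conj_mul_ne_zero hp (mem_ball_zero_iff.1 hz).le

theorem exists_mapsTo_ball {χ : ℂ → ℂ} (hχ : ContinuousOn χ disk) (hm : MapsTo χ disk disk)
    {s : ℝ} (hs : s ∈ Ioo (0 : ℝ) 1) :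
    ∃ r ∈ Ioo (0 : ℝ) 1, MapsTo χ (closedBall 0 s) (ball 0 r) := by
  have hcd : closedBall (0 : ℂ) s ⊆ disk := closedBall_subset_ball hs.2
  obtain ⟨z₀, hz₀, hmax⟩ := (isCompact_closedBall (0 : ℂ) s).exists_isMaxOn
    ⟨0, mem_closedBall_self hs.1.le⟩ (hχ.mono hcd).norm
  have h1 : ‖χ z₀‖ < 1 := mem_ball_zero_iff.1 (hm (hcd hz₀))
  refine ⟨(‖χ z₀‖ + 1) / 2, ⟨by positivity, by linarith⟩, fun z hz => mem_ball_zero_iff.2 ?_⟩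
  have : ‖χ z‖ ≤ ‖χ z₀‖ := hmax hz
  linarith

/-- The constant compares `|kern p|²` with the Poisson kernel at `p` of the circle of radius `s`;
the two agree on the unit circle, so it tends to `1` as `s → 1`. -/
theorem mean_kern_mul_comp_mob_le (hc : ‖c‖ = 1) (hp : ‖p‖ < 1) (f : H2) {s : ℝ}
    (hs : s ∈ Ioo (0 : ℝ) 1) (hps : ‖p‖ < s) :
    mean (fun z => kern p z * f (mob c p z)) s ≤
      (1 - ‖p‖ ^ 2) / (s ^ 2 - ‖p‖ ^ 2) * ‖f‖ ^ 2 := by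
  have hmaps : MapsTo (mob c p) disk disk := fun z hz => mob_mem_disk hc hp hz
  obtain ⟨r, hr, hmap⟩ := exists_mapsTo_ball (differentiableOn_mob hp (c := c)).continuousOn
    hmaps hs
  have h := (poisson_comp_le_mean f.differentiableOn (differentiableOn_mob hp (c := c)) hr hs hmap
    (mem_ball_zero_iff.2 hps) mob_self).trans (H2.mean_le f hr)
  have h1 : 0 < 1 - ‖p‖ ^ 2 := by nlinarith [norm_nonneg p]
  have h2 : 0 < s ^ 2 - ‖p‖ ^ 2 := by nlinarith [norm_nonneg p]
  have hfd : DifferentiableOn ℂ (fun z => f (mob c p z)) disk :=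
    f.differentiableOn.comp (differentiableOn_mob hp) hmaps
  have hd := (differentiableOn_kern hp).mul hfd
  have h3 : mean (fun z => kern p z * f (mob c p z)) s ≤
      Real.circleAverage (fun z => ((1 - ‖p‖ ^ 2) / (s ^ 2 - ‖p‖ ^ 2)) •
        (poissonKernel 0 p • fun z => ‖f (mob c p z)‖ ^ 2) z) 0 s := by
    refine Real.circleAverage_mono (circleIntegrable_norm_sq hd hs) ?_ fun z hz => ?_
    · exact (((poissonKernel_continuousOn hs.1 hps).smul
        ((continuousOn_sphere hfd hs).norm.pow 2)).circleIntegrable').const_fun_smul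
    · have hz' : ‖z‖ = s := by simpa [abs_of_pos hs.1] using hz
      have hzp : 0 < ‖z - p‖ := by
        refine norm_pos_iff.2 fun h => ?_
        rw [sub_eq_zero.1 h] at hz'
        exact hps.ne hz'
      have h4 := norm_sq_one_sub_conj_mul p z
      have h5 : 0 ≤ (1 - ‖p‖ ^ 2) * (1 - ‖z‖ ^ 2) := by
        rw [hz']
        exact mul_nonneg h1.le (by nlinarith [hs.1, hs.2])
      simp only [Pi.smul_apply', smul_eq_mul, norm_mul, mul_pow, norm_kern_sq hp,
        poissonKernel_def, sub_zero, hz']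
      rw [← mul_assoc, div_mul_div_cancel₀ h2.ne']
      gcongr
      exact le_of_sq_le_sq (by linarith) (norm_nonneg _)
  rw [Real.circleAverage_fun_smul, smul_eq_mul] at h3
  exact h3.trans (mul_le_mul_of_nonneg_left h (by positivity))

/-- The operator `f ↦ kern p · (f ∘ mob c p)` is a contraction of `H²` (in fact an isometry). -/
theorem exists_kern_mul_comp_mob (hc : ‖c‖ = 1) (hp : ‖p‖ < 1) (f : H2) :
    ∃ F : H2, (∀ z ∈ disk, F z = kern p z * f (mob c p z)) ∧ ‖F‖ ≤ 1 * ‖f‖ := by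
  have hd : DifferentiableOn ℂ (fun z => kern p z * f (mob c p z)) disk :=
    (differentiableOn_kern hp).mul
      (f.differentiableOn.comp (differentiableOn_mob hp) fun z hz => mob_mem_disk hc hp hz)
  refine exists_H2 hd (by positivity) fun s hs => ?_
  have h1 : 0 < 1 - ‖p‖ ^ 2 := by nlinarith [norm_nonneg p]
  have hlim : Tendsto (fun t : ℝ => (1 - ‖p‖ ^ 2) / (t ^ 2 - ‖p‖ ^ 2) * ‖f‖ ^ 2) (𝓝[<] 1)
      (𝓝 ((1 - ‖p‖ ^ 2) / (1 ^ 2 - ‖p‖ ^ 2) * ‖f‖ ^ 2)) := by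
    apply Tendsto.mono_left _ nhdsWithin_le_nhds
    apply ContinuousAt.tendsto
    have : (1 : ℝ) ^ 2 - ‖p‖ ^ 2 ≠ 0 := by rw [one_pow]; exact h1.ne'
    fun_prop (disch := assumption)
  rw [one_pow, div_self h1.ne'] at hlim
  rw [mul_pow, one_pow]
  refine ge_of_tendsto hlim ?_
  filter_upwards [Ioo_mem_nhdsLT (max_lt hs.2 hp)] with t ht
  have hst := (le_max_left s ‖p‖).trans_lt ht.1
  have ht' : t ∈ Ioo (0 : ℝ) 1 := ⟨hs.1.trans hst, ht.2⟩
  exact (mean_monotone hd hs ht' hst).trans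
    (mean_kern_mul_comp_mob_le hc hp f ht' ((le_max_right s ‖p‖).trans_lt ht.1))

end Mobius

/-- Point evaluations: `|f(w)| √(1 - |w|²) ≤ ‖f‖`. -/
theorem norm_apply_mul_le (f : H2) {w : ℂ} (hw : w ∈ disk) : ‖f w‖ * √(1 - ‖w‖ ^ 2) ≤ ‖f‖ := by
  obtain ⟨F, hF, hn⟩ := exists_kern_mul_comp_mob (c := 1) (p := -w) norm_one
    (by simpa using hw) f
  have h := (norm_apply_zero_le F).trans hn
  rw [hF 0 (mem_ball_self one_pos)] at h
  simpa [kern, mob, mul_comm, abs_of_nonneg (Real.sqrt_nonneg _)] using h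

/-- Normalized reproducing kernels: they are extremal for the point evaluations. -/
theorem exists_extremal {w : ℂ} (hw : w ∈ disk) :
    ∃ k : H2, ‖k‖ ≤ 1 ∧ ‖k w‖ * √(1 - ‖w‖ ^ 2) = 1 := by
  have hw' : ‖w‖ < 1 := mem_ball_zero_iff.1 hw
  obtain ⟨o, ho, hn⟩ := exists_H2 (f := fun _ => 1) (differentiableOn_const 1) zero_le_one
    (fun r _ => by simp [mean, Real.circleAverage_const])
  obtain ⟨k, hk, hkn⟩ := exists_kern_mul_comp_mob (c := 1) norm_one hw' o
  refine ⟨k, hkn.trans (by simpa using hn), ?_⟩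
  have h1 : 0 < 1 - ‖w‖ ^ 2 := by nlinarith [norm_nonneg w]
  rw [hk w hw, ho _ (mob_mem_disk norm_one hw' hw), mul_one]
  have h := norm_kern_sq_mul (c := 1) norm_one hw' hw'.le
  rw [mob_self] at h
  rw [← Real.sqrt_sq (norm_nonneg (kern w w)), ← Real.sqrt_mul (by positivity), h]
  simp

end HardyDisk

namespace HardyDisk

/-! ### Completeness of `H²` -/

theorem norm_apply_le (f : H2) {w : ℂ} (hw : w ∈ disk) : ‖f w‖ ≤ ‖f‖ / √(1 - ‖w‖ ^ 2) := by
  have hw' : ‖w‖ < 1 := mem_ball_zero_iff.1 hw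
  rw [le_div_iff₀ (Real.sqrt_pos.2 (by nlinarith [norm_nonneg w]))]
  exact norm_apply_mul_le f hw

theorem norm_apply_le_of_le (f : H2) {r : ℝ} (hr : r < 1) {w : ℂ} (hw : ‖w‖ ≤ r) :
    ‖f w‖ ≤ ‖f‖ / √(1 - r ^ 2) := by
  have h0 := (norm_nonneg w).trans hw
  refine (norm_apply_le f (mem_ball_zero_iff.2 (hw.trans_lt hr))).trans ?_
  gcongr
  exact Real.sqrt_pos.2 (by nlinarith)

theorem mean_le_of_tendsto {F : ℕ → H2} {C : ℝ} (hF : ∀ᶠ n in atTop, ‖F n‖ ≤ C) {g : ℂ → ℂ}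
    (hg : ∀ z ∈ disk, Tendsto (fun n => F n z) atTop (𝓝 (g z))) {r : ℝ}
    (hr : r ∈ Ioo (0 : ℝ) 1) : mean g r ≤ C ^ 2 := by
  have hlim : Tendsto (fun n => mean (F n) r) atTop (𝓝 (mean g r)) := by
    simp only [mean, Real.circleAverage_def]
    refine Tendsto.const_smul ?_ _
    refine intervalIntegral.tendsto_integral_filter_of_dominated_convergence
      (fun _ => (C / √(1 - r ^ 2)) ^ 2) ?_ ?_ (by simp) ?_
    · exact Eventually.of_forall fun n =>
        (continuous_circle (F n).differentiableOn hr).aestronglyMeasurable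
    · filter_upwards [hF] with n hn
      refine Eventually.of_forall fun θ _ => ?_
      rw [norm_pow, norm_norm]
      gcongr
      refine (norm_apply_le_of_le (F n) hr.2 (by simp [abs_of_pos hr.1])).trans ?_
      gcongr
    · exact Eventually.of_forall fun θ _ => ((hg _ (circleMap_mem_disk hr θ)).norm.pow 2)
  refine le_of_tendsto hlim ?_
  filter_upwards [hF] with n hn
  refine (H2.mean_le (F n) hr).trans ?_
  gcongr

instance : CompleteSpace H2 := by
  refine Metric.complete_of_cauchySeq_tendsto fun F hF => ?_
  have hpt : ∀ z : ℂ, ∃ y, z ∈ disk → Tendsto (fun n => F n z) atTop (𝓝 y) := by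
    intro z
    by_cases hz : z ∈ disk
    · have : CauchySeq fun n => F n z := by
        refine Metric.cauchySeq_iff.2 fun ε hε => ?_
        have hz' : 0 < √(1 - ‖z‖ ^ 2) := by
          have : ‖z‖ < 1 := mem_ball_zero_iff.1 hz
          exact Real.sqrt_pos.2 (by nlinarith [norm_nonneg z])
        obtain ⟨N, hN⟩ := Metric.cauchySeq_iff.1 hF (ε * √(1 - ‖z‖ ^ 2)) (by positivity)
        refine ⟨N, fun m hm n hn => ?_⟩
        have h1 := norm_apply_le (F m - F n) hz
        have h2 := hN m hm n hn
        rw [dist_eq_norm] at h2 ⊢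
        rw [H2.sub_apply] at h1
        exact h1.trans_lt ((div_lt_iff₀ hz').2 h2)
      obtain ⟨y, hy⟩ := cauchySeq_tendsto_of_complete this
      exact ⟨y, fun _ => hy⟩
    · exact ⟨0, fun h => absurd h hz⟩
  choose g hg using hpt
  have hu : TendstoLocallyUniformlyOn (fun n => (F n : ℂ → ℂ)) g atTop disk := by
    rw [tendstoLocallyUniformlyOn_iff_forall_isCompact isOpen_ball]
    intro K hK hKc
    obtain ⟨r, hr, hKr⟩ : ∃ r < 1, K ⊆ closedBall (0 : ℂ) r := by
      obtain ⟨r, hr, h⟩ := exists_lt_subset_ball hKc.isClosed hK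
      exact ⟨r, hr, h.trans ball_subset_closedBall⟩
    by_cases hr0 : 0 ≤ r
    swap
    · rw [closedBall_eq_empty.2 (not_le.1 hr0), subset_empty_iff] at hKr
      rw [hKr]
      exact tendstoUniformlyOn_empty
    have hs : 0 < √(1 - r ^ 2) := Real.sqrt_pos.2 (by nlinarith)
    refine Metric.tendstoUniformlyOn_iff.2 fun ε hε => ?_
    obtain ⟨N, hN⟩ := Metric.cauchySeq_iff.1 hF (ε / 2 * √(1 - r ^ 2)) (by positivity)
    filter_upwards [eventually_ge_atTop N] with n hn z hz
    have hle : dist (g z) (F n z) ≤ ε / 2 := by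
      refine le_of_tendsto ((hg z (hK hz)).dist tendsto_const_nhds) ?_
      filter_upwards [eventually_ge_atTop N] with m hm
      have h1 := norm_apply_le_of_le (F m - F n) hr (mem_closedBall_zero_iff.1 (hKr hz))
      have h2 := hN m hm n hn
      rw [dist_eq_norm] at h2 ⊢
      exact h1.trans ((div_le_iff₀ hs).2 h2.le)
    linarith
  have hgd : DifferentiableOn ℂ g disk :=
    hu.differentiableOn (Eventually.of_forall fun n => (F n).differentiableOn) isOpen_ball
  have hclose : ∀ ε > 0, ∃ N, ∀ n ≥ N, ∃ E : H2, (∀ z ∈ disk, E z = g z - F n z) ∧ ‖E‖ ≤ ε := by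
    intro ε hε
    obtain ⟨N, hN⟩ := Metric.cauchySeq_iff.1 hF ε hε
    refine ⟨N, fun n hn => exists_H2 (hgd.sub (F n).differentiableOn) hε.le fun r hr => ?_⟩
    refine mean_le_of_tendsto (F := fun m => F m - F n) ?_ (fun z hz => ?_) hr
    · filter_upwards [eventually_ge_atTop N] with m hm
      rw [← dist_eq_norm]
      exact (hN m hm n hn).le
    · exact (hg z hz).sub tendsto_const_nhds
  obtain ⟨N, hN⟩ := hclose 1 one_pos
  obtain ⟨E, hE, -⟩ := hN N le_rfl
  refine ⟨E + F N, Metric.tendsto_atTop.2 fun ε hε => ?_⟩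
  obtain ⟨M, hM⟩ := hclose (ε / 2) (by positivity)
  refine ⟨M, fun n hn => ?_⟩
  obtain ⟨E', hE', hn'⟩ := hM n hn
  have : E + F N - F n = E' := H2.ext fun z hz => by
    simp only [H2.sub_apply, H2.add_apply, hE z hz, hE' z hz]
    ring
  rw [dist_comm, dist_eq_norm, this]
  linarith

/-! ### Automorphisms of the disk are Möbius maps -/

/-- The inverse of a holomorphic bijection of the disk is holomorphic: it is continuous by the open
mapping theorem, and the isolated critical values are removable singularities. -/
theorem differentiableOn_inverse {F G : ℂ → ℂ} (hF : IsAutomorphism F) (hG : MapsTo G disk disk)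
    (hGF : ∀ z ∈ disk, G (F z) = z) (hFG : ∀ w ∈ disk, F (G w) = w) :
    DifferentiableOn ℂ G disk := by
  have hd : IsOpen disk := isOpen_ball
  have hFa : AnalyticOnNhd ℂ F disk := hF.1.analyticOnNhd hd
  have h0 : (0 : ℂ) ∈ disk := mem_ball_self one_pos
  have hhalf : (1 / 2 : ℂ) ∈ disk := by
    refine mem_ball_zero_iff.2 ?_
    norm_num
  have hopen : ∀ s ⊆ disk, IsOpen s → IsOpen (F '' s) := by
    rcases hFa.is_constant_or_isOpen (convex_ball 0 1).isPreconnected with ⟨w, hw⟩ | h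
    · have := hF.2.injOn h0 hhalf (by rw [hw 0 h0, hw _ hhalf])
      norm_num at this
    · exact h
  have hcont : ∀ w ∈ disk, ContinuousAt G w := by
    intro w hw
    refine tendsto_def.2 fun V hV => ?_
    obtain ⟨V', hV', hV'o, hwV⟩ := _root_.mem_nhds_iff.1 hV
    have : F '' (V' ∩ disk) ∈ 𝓝 w :=
      (hopen _ inter_subset_right (hV'o.inter hd)).mem_nhds ⟨G w, ⟨hwV, hG hw⟩, hFG w hw⟩
    refine mem_of_superset this ?_
    rintro _ ⟨z, ⟨hz, hz'⟩, rfl⟩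
    rw [mem_preimage, hGF z hz']
    exact hV' hz
  intro w₀ hw₀
  have hz₀ := hG hw₀
  have hne : ∀ᶠ z in 𝓝[≠] G w₀, deriv F z ≠ 0 := by
    rcases (hFa _ hz₀).deriv.eventually_eq_zero_or_eventually_ne_zero with h | h
    · exfalso
      obtain ⟨ε, hε, hball⟩ := Metric.eventually_nhds_iff_ball.1
        (h.and (hd.mem_nhds hz₀))
      have hconst : ∀ x ∈ ball (G w₀) ε, F x = F (G w₀) := fun x hx =>
        isOpen_ball.is_const_of_deriv_eq_zero (convex_ball _ _).isPreconnected
          (hF.1.mono fun y hy => (hball y hy).2) (fun y hy => (hball y hy).1) hx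
          (mem_ball_self hε)
      have hx : G w₀ + (ε / 2 : ℝ) ∈ ball (G w₀) ε := by
        rw [mem_ball, dist_eq_norm, add_sub_cancel_left, Complex.norm_real,
          Real.norm_of_nonneg (by positivity)]
        linarith
      have := hF.2.injOn (hball _ hx).2 hz₀ (hconst _ hx)
      rw [add_eq_left, Complex.ofReal_eq_zero] at this
      linarith
    · exact h
  have hev : ∀ᶠ w in 𝓝[≠] w₀, DifferentiableAt ℂ G w := by
    have ht : Tendsto G (𝓝[≠] w₀) (𝓝[≠] G w₀) := by
      refine tendsto_nhdsWithin_iff.2 ⟨(hcont w₀ hw₀).tendsto.mono_left nhdsWithin_le_nhds, ?_⟩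
      filter_upwards [self_mem_nhdsWithin, nhdsWithin_le_nhds (hd.mem_nhds hw₀)] with w hw hw'
      intro h
      exact hw (by rw [mem_singleton_iff, ← hFG w hw', ← hFG w₀ hw₀, h])
    filter_upwards [ht.eventually hne, nhdsWithin_le_nhds (hd.mem_nhds hw₀)] with w hw hw'
    have hFd : DifferentiableAt ℂ F (G w) := (hFa _ (hG hw')).differentiableAt
    refine (HasDerivAt.of_local_left_inverse (hcont w hw') hFd.hasDerivAt hw ?_).differentiableAt
    filter_upwards [hd.mem_nhds hw'] with y hy using hFG y hy
  exact (Complex.analyticAt_of_differentiable_on_punctured_nhds_of_continuousAt hev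
    (hcont w₀ hw₀)).differentiableAt.differentiableWithinAt

theorem IsAutomorphism.exists_mob {φ : ℂ → ℂ} (hφ : IsAutomorphism φ) :
    ∃ c p : ℂ, ‖c‖ = 1 ∧ ‖p‖ < 1 ∧ EqOn φ (mob c p) disk := by
  have h0 : (0 : ℂ) ∈ disk := mem_ball_self one_pos
  set G := Function.invFunOn φ disk
  have hinv : InvOn G φ disk disk := hφ.2.invOn_invFunOn
  have hG : MapsTo G disk disk := hφ.2.surjOn.mapsTo_invFunOn
  have hGd := differentiableOn_inverse hφ hG hinv.1 hinv.2
  set p := G 0 with hp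
  have hp1 : ‖p‖ < 1 := mem_ball_zero_iff.1 (hG h0)
  have hp1' : ‖-p‖ < 1 := by rwa [norm_neg]
  have hm : MapsTo (mob 1 (-p)) disk disk := fun z hz => mob_mem_disk norm_one hp1' hz
  have hm' : MapsTo (mob 1 p) disk disk := fun z hz => mob_mem_disk norm_one hp1 hz
  have hmm' : ∀ z ∈ disk, mob 1 p (mob 1 (-p) z) = z := fun z hz => by
    simpa using mob_mob_inv (c := 1) norm_one hp1' hz
  have hmm : ∀ z ∈ disk, mob 1 (-p) (mob 1 p z) = z := fun z hz => by
    simpa using mob_mob_inv (c := 1) norm_one hp1 hz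
  have hK0 : φ (mob 1 (-p) 0) = 0 := by
    have : mob 1 (-p) 0 = p := by simp [mob]
    rw [this, hp]
    exact hinv.2 h0
  have hKd : DifferentiableOn ℂ (φ ∘ mob 1 (-p)) disk :=
    hφ.1.comp (differentiableOn_mob hp1') hm
  have hKm : MapsTo (φ ∘ mob 1 (-p)) disk disk := hφ.2.mapsTo.comp hm
  have hnorm : ∀ z ∈ disk, ‖(φ ∘ mob 1 (-p)) z‖ = ‖z‖ := by
    intro z hz
    refine le_antisymm (Complex.norm_le_norm_of_mapsTo_ball hKd
      (fun x hx => ball_subset_closedBall (hKm hx)) hK0 (mem_ball_zero_iff.1 hz)) ?_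
    have h := Complex.norm_le_norm_of_mapsTo_ball (f := mob 1 p ∘ G)
      ((differentiableOn_mob hp1).comp hGd hG)
      (fun x hx => ball_subset_closedBall (hm' (hG hx))) mob_self
      (mem_ball_zero_iff.1 (hKm hz))
    rwa [Function.comp_apply, Function.comp_apply, hinv.1 (hm hz), hmm' z hz] at h
  have hhalf : (1 / 2 : ℂ) ∈ disk := by
    refine mem_ball_zero_iff.2 ?_
    norm_num
  obtain ⟨C, hC, hKC⟩ := Complex.affine_of_mapsTo_ball_of_exists_norm_dslope_eq_div'
    (f := φ ∘ mob 1 (-p)) (c := 0) (R₁ := 1) (R₂ := 1) hKd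
    (by
      intro x hx
      rw [Function.comp_apply (x := (0 : ℂ)), hK0]
      exact ball_subset_closedBall (hKm hx))
    ⟨1 / 2, hhalf, by
      rw [dslope_of_ne _ (by norm_num), slope_def_module, Function.comp_apply (x := (0 : ℂ)), hK0,
        sub_zero, sub_zero, norm_smul, hnorm _ hhalf]
      norm_num⟩
  refine ⟨C, p, by simpa using hC, hp1, fun z hz => ?_⟩
  have h := hKC (hm' hz)
  simp only [Function.comp_apply, hK0, hmm z hz, sub_zero, zero_add, smul_eq_mul] at h
  rw [h, mob, mob]
  ring

/-! ### Hyperbolic automorphisms in half-plane coordinates -/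

/-- The Möbius map of the disk onto the right half-plane sending `a` to `∞` and `b` to `0`
(for distinct unimodular `a`, `b`). -/
noncomputable def halfPlane (a b z : ℂ) : ℂ :=
  (1 - conj a * b) * (1 - conj b * z) / (1 - conj a * z)

section HalfPlane
variable {a b c p z : ℂ}

theorem mul_conj_eq_one (ha : ‖a‖ = 1) : a * conj a = 1 := by
  rw [Complex.mul_conj, Complex.normSq_eq_norm_sq, ha]
  simp

theorem one_sub_conj_mul_eq (ha : ‖a‖ = 1) (z : ℂ) : 1 - conj a * z = conj a * (a - z) := by
  linear_combination -mul_conj_eq_one ha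

theorem norm_one_sub_conj_mul (ha : ‖a‖ = 1) (z : ℂ) : ‖1 - conj a * z‖ = ‖z - a‖ := by
  rw [one_sub_conj_mul_eq ha, norm_mul, RCLike.norm_conj, ha, one_mul, norm_sub_rev]

theorem one_sub_conj_mul_ne_zero' (ha : ‖a‖ = 1) (hz : z ∈ disk) : 1 - conj a * z ≠ 0 := by
  rw [← norm_pos_iff, norm_one_sub_conj_mul ha, norm_pos_iff, sub_ne_zero]
  rintro rfl
  exact (mem_ball_zero_iff.1 hz).ne ha

theorem re_halfPlane_pos (ha : ‖a‖ = 1) (hb : ‖b‖ = 1) (hab : b ≠ a) (hz : z ∈ disk) :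
    0 < (halfPlane a b z).re := by
  have hA := mul_conj_eq_one ha
  have hB := mul_conj_eq_one hb
  have hden := one_sub_conj_mul_ne_zero' ha hz
  have key : halfPlane a b z + conj (halfPlane a b z)
      = ((‖1 - conj a * b‖ ^ 2 * (1 - ‖z‖ ^ 2) / ‖1 - conj a * z‖ ^ 2 : ℝ) : ℂ) := by
    have hden' : 1 - a * conj z ≠ 0 := by
      have := (map_ne_zero (starRingEnd ℂ)).2 hden
      simpa using this
    push_cast
    rw [← Complex.mul_conj', ← Complex.mul_conj', ← Complex.mul_conj']
    simp only [halfPlane, map_div₀, map_mul, map_sub, map_one, Complex.conj_conj]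
    rw [div_add_div _ _ hden hden']
    congr 1
    linear_combination (b * conj z + conj b * z - b * conj b * (1 + z * conj z)) * hA
      + (conj a * z + a * conj z - (1 + z * conj z)) * hB
  have h2 := congrArg Complex.re key
  simp only [Complex.add_re, Complex.conj_re, Complex.ofReal_re] at h2
  have h3 : 0 < ‖1 - conj a * b‖ := by
    rw [norm_one_sub_conj_mul ha]
    exact norm_pos_iff.2 (sub_ne_zero.2 hab)
  have h4 : 0 < 1 - ‖z‖ ^ 2 := by
    have : ‖z‖ < 1 := mem_ball_zero_iff.1 hz
    nlinarith [norm_nonneg z]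
  have h5 := norm_pos_iff.2 hden
  have : 0 < ‖1 - conj a * b‖ ^ 2 * (1 - ‖z‖ ^ 2) / ‖1 - conj a * z‖ ^ 2 := by positivity
  linarith

theorem differentiableOn_halfPlane (ha : ‖a‖ = 1) :
    DifferentiableOn ℂ (halfPlane a b) disk := by
  refine DifferentiableOn.div (by fun_prop) differentiableOn_one_sub fun z hz =>
    one_sub_conj_mul_ne_zero' ha hz

theorem norm_halfPlane (ha : ‖a‖ = 1) (hb : ‖b‖ = 1) (z : ℂ) :
    ‖halfPlane a b z‖ = ‖b - a‖ * ‖z - b‖ / ‖z - a‖ := by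
  rw [halfPlane, norm_div, norm_mul, norm_one_sub_conj_mul ha, norm_one_sub_conj_mul hb,
    norm_one_sub_conj_mul ha]

theorem mob_sub_mob {w : ℂ} (hz : 1 - conj p * z ≠ 0) (hw : 1 - conj p * w ≠ 0) :
    mob c p z - mob c p w
      = c * (1 - conj p * p) * (z - w) / ((1 - conj p * z) * (1 - conj p * w)) := by
  rw [mob, mob, div_sub_div _ _ hz hw]
  congr 1
  ring

theorem hasDerivAt_mob (hz : 1 - conj p * z ≠ 0) :
    HasDerivAt (mob c p) (c * (1 - conj p * p) / (1 - conj p * z) ^ 2) z := by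
  have h1 : HasDerivAt (fun z => c * (z - p)) c z := by
    simpa using ((hasDerivAt_id z).sub_const p).const_mul c
  have h2 : HasDerivAt (fun z => 1 - conj p * z) (-conj p) z := by
    simpa using ((hasDerivAt_id z).const_mul (conj p)).const_sub 1
  refine (h1.div h2 hz).congr_deriv ?_
  congr 1
  ring

/-- At a boundary fixed point the derivative of a Möbius automorphism is real and positive. -/
theorem deriv_mob_eq (hp : ‖p‖ < 1) (ha : ‖a‖ = 1) (hfix : mob c p a = a) :
    c * (1 - conj p * p) / (1 - conj p * a) ^ 2 = ((‖kern p a‖ ^ 2 : ℝ) : ℂ) := by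
  have hA := mul_conj_eq_one ha
  have hden := one_sub_conj_mul_ne_zero hp ha.le
  have hden' : 1 - p * conj a ≠ 0 := by
    have := (map_ne_zero (starRingEnd ℂ)).2 hden
    simpa using this
  have h1 : c * (a - p) = a * (1 - conj p * a) := by
    rwa [mob, div_eq_iff hden] at hfix
  have ha0 : a ≠ 0 := by
    rintro rfl
    simp at ha
  have h2 : c * (1 - p * conj a) = 1 - conj p * a := by
    apply mul_left_cancel₀ ha0
    linear_combination h1 - c * p * hA
  rw [norm_kern_sq hp]
  push_cast
  rw [← Complex.mul_conj', ← Complex.mul_conj']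
  simp only [map_mul, map_sub, map_one, Complex.conj_conj]
  rw [div_eq_div_iff (pow_ne_zero 2 hden) (mul_ne_zero hden hden')]
  linear_combination (1 - conj p * p) * (1 - conj p * a) * h2

/-- The derivatives at the two fixed points of a hyperbolic automorphism are reciprocal, and the
automorphism is a dilation in half-plane coordinates. -/
theorem halfPlane_mob (hp : ‖p‖ < 1) (ha : ‖a‖ = 1) (hb : ‖b‖ = 1) (hab : b ≠ a)
    (hfa : mob c p a = a) (hfb : mob c p b = b) :
    ‖kern p a‖ ^ 2 = (‖kern p b‖ ^ 2)⁻¹ ∧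
      ∀ z ∈ disk, halfPlane a b (mob c p z) = ((‖kern p b‖ ^ 2 : ℝ) : ℂ) * halfPlane a b z := by
  have hda := one_sub_conj_mul_ne_zero hp ha.le
  have hdb := one_sub_conj_mul_ne_zero hp hb.le
  have h1 : c * (1 - conj p * p) = (1 - conj p * a) * (1 - conj p * b) := by
    have := mob_sub_mob (c := c) hdb hda
    rw [hfa, hfb, eq_div_iff (mul_ne_zero hdb hda)] at this
    apply mul_right_cancel₀ (sub_ne_zero.2 hab)
    linear_combination -this
  have h2 := deriv_mob_eq hp ha hfa
  have h3 := deriv_mob_eq hp hb hfb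
  have h4 : ((‖kern p b‖ ^ 2 : ℝ) : ℂ) = (1 - conj p * a) / (1 - conj p * b) := by
    rw [← h3, h1]
    field_simp
  constructor
  · rw [← Complex.ofReal_inj, Complex.ofReal_inv, h4, ← h2, h1]
    field_simp
  · intro z hz
    have hz' := one_sub_conj_mul_ne_zero hp (mem_ball_zero_iff.1 hz).le
    have hA := mul_conj_eq_one ha
    have e : ∀ x : ℂ, ‖x‖ = 1 → 1 - conj p * x ≠ 0 → mob c p x = x →
        1 - conj x * mob c p z = (1 - conj x * z) * (c * (1 - conj p * p)) /
          ((1 - conj p * x) * (1 - conj p * z)) := by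
      intro x hx hdx hfx
      rw [one_sub_conj_mul_eq hx, one_sub_conj_mul_eq hx z]
      nth_rewrite 2 [← hfx]
      rw [mob_sub_mob hdx hz']
      ring
    have hda0 := one_sub_conj_mul_ne_zero' ha hz
    rw [h4, halfPlane, halfPlane, e a ha hda hfa, e b hb hdb hfb, h1]
    generalize 1 - conj p * z = Z at *
    generalize 1 - conj p * a = A at *
    generalize 1 - conj p * b = B at *
    field_simp

end HalfPlane

theorem boundaryExt_eq {φ : ℂ → ℂ} {c p : ℂ} (hp : ‖p‖ < 1) (hφ : EqOn φ (mob c p) disk) {z : ℂ}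
    (hz : z ∈ closedBall (0 : ℂ) 1) : boundaryExt φ z = mob c p z := by
  refine extendFrom_eq (by rwa [closure_ball 0 one_ne_zero]) ?_
  have h := (hasDerivAt_mob (c := c)
    (one_sub_conj_mul_ne_zero hp (mem_closedBall_zero_iff.1 hz))).continuousAt
  refine (h.tendsto.mono_left nhdsWithin_le_nhds).congr' ?_
  filter_upwards [self_mem_nhdsWithin] with w hw using (hφ hw).symm

theorem hasDerivWithinAt_boundaryExt {φ : ℂ → ℂ} {c p x : ℂ} (hp : ‖p‖ < 1)
    (hφ : EqOn φ (mob c p) disk) (hx : ‖x‖ = 1) (hfix : mob c p x = x) :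
    HasDerivWithinAt (boundaryExt φ) ((‖kern p x‖ ^ 2 : ℝ) : ℂ) (closedBall 0 1) x := by
  have h := (hasDerivAt_mob (c := c) (one_sub_conj_mul_ne_zero hp hx.le)).hasDerivWithinAt
    (s := closedBall 0 1)
  rw [deriv_mob_eq hp hx hfix] at h
  exact h.congr (fun y hy => boundaryExt_eq hp hφ hy)
    (boundaryExt_eq hp hφ (mem_closedBall_zero_iff.2 hx.le))

/-- The orbit of `0` converges to the Denjoy-Wolff point, so the dilation factor exceeds `1`. -/
theorem one_lt_of_denjoyWolff {φ : ℂ → ℂ} {a b : ℂ} {μ : ℝ} (hμ : 0 ≤ μ)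
    (hmaps : MapsTo φ disk disk) (ha : ‖a‖ = 1) (hb : ‖b‖ = 1) (hab : b ≠ a)
    (hconj : ∀ z ∈ disk, halfPlane a b (φ z) = μ * halfPlane a b z)
    (hDW : IsDenjoyWolffPoint φ a) : 1 < μ := by
  by_contra! hle
  have h0 : (0 : ℂ) ∈ disk := mem_ball_self one_pos
  have hmem : ∀ n, φ^[n] 0 ∈ disk := fun n => hmaps.iterate n h0
  have hlim : Tendsto (fun n => φ^[n] 0) atTop (𝓝 a) :=
    (hDW.2 {0} (by simp) isCompact_singleton).tendsto_at rfl
  have hQ : ∀ n, ‖halfPlane a b (φ^[n] 0)‖ ≤ ‖halfPlane a b 0‖ := by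
    intro n
    induction n with
    | zero => rfl
    | succ n ih =>
      rw [Function.iterate_succ_apply', hconj _ (hmem n), norm_mul, Complex.norm_real,
        Real.norm_of_nonneg hμ]
      nlinarith [norm_nonneg (halfPlane a b (φ^[n] 0))]
  have hle' : ∀ n, ‖b - a‖ * ‖φ^[n] 0 - b‖ ≤ ‖halfPlane a b 0‖ * ‖φ^[n] 0 - a‖ := by
    intro n
    have h := hQ n
    have hpos : 0 < ‖φ^[n] 0 - a‖ := by
      rw [← norm_one_sub_conj_mul ha]
      exact norm_pos_iff.2 (one_sub_conj_mul_ne_zero' ha (hmem n))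
    rwa [norm_halfPlane ha hb, div_le_iff₀ hpos] at h
  have h := le_of_tendsto_of_tendsto' (((hlim.sub_const b).norm).const_mul ‖b - a‖)
    (((hlim.sub_const a).norm).const_mul ‖halfPlane a b 0‖) hle'
  rw [sub_self, norm_zero, mul_zero, norm_sub_rev a b] at h
  have : 0 < ‖b - a‖ := norm_pos_iff.2 (sub_ne_zero.2 hab)
  nlinarith

end HardyDisk

namespace HardyDisk

/-! ### Dilations in half-plane coordinates -/

/-- The inverse of `mob c p` on the disk. -/
noncomputable def mobInv (c p : ℂ) : ℂ → ℂ := mob (conj c) (-(c * p))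

/-- The Möbius automorphism `mob c p` acts in the half-plane coordinate centred at the boundary
points `a ↔ ∞`, `b ↔ 0` as the dilation by `μ > 1`. -/
structure IsDilation (c p a b : ℂ) (μ : ℝ) : Prop where
  norm_c : ‖c‖ = 1
  norm_p : ‖p‖ < 1
  norm_a : ‖a‖ = 1
  norm_b : ‖b‖ = 1
  ne : b ≠ a
  one_lt : 1 < μ
  halfPlane_mob : ∀ z ∈ disk, halfPlane a b (mob c p z) = μ * halfPlane a b z

namespace IsDilation
variable {c p a b : ℂ} {μ : ℝ}

theorem mapsTo (h : IsDilation c p a b μ) : MapsTo (mob c p) disk disk :=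
  fun _ hz => mob_mem_disk h.norm_c h.norm_p hz

theorem norm_mobInv_center (h : IsDilation c p a b μ) : ‖-(c * p)‖ < 1 := by
  rw [norm_neg, norm_mul, h.norm_c, one_mul]
  exact h.norm_p

theorem norm_conj_c (h : IsDilation c p a b μ) : ‖conj c‖ = 1 := by
  rw [RCLike.norm_conj, h.norm_c]

theorem mapsTo_inv (h : IsDilation c p a b μ) : MapsTo (mobInv c p) disk disk :=
  fun _ hz => mob_mem_disk h.norm_conj_c h.norm_mobInv_center hz

theorem inv_mob (h : IsDilation c p a b μ) {z : ℂ} (hz : z ∈ disk) :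
    mobInv c p (mob c p z) = z := mob_mob_inv h.norm_c h.norm_p hz

theorem mob_inv (h : IsDilation c p a b μ) {z : ℂ} (hz : z ∈ disk) :
    mob c p (mobInv c p z) = z := by
  have := mob_mob_inv h.norm_conj_c h.norm_mobInv_center hz
  rwa [Complex.conj_conj, mul_neg, neg_neg, ← mul_assoc, mul_comm (conj c),
    mul_conj_eq_one h.norm_c, one_mul] at this

/-- The equality case of the Schwarz-Pick inequality, as a relation between the norms of point
evaluations. -/
theorem norm_kern_mul (h : IsDilation c p a b μ) {z : ℂ} (hz : z ∈ disk) :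
    ‖kern p z‖ * √(1 - ‖z‖ ^ 2) = √(1 - ‖mob c p z‖ ^ 2) := by
  rw [← norm_kern_sq_mul h.norm_c h.norm_p (mem_ball_zero_iff.1 hz).le,
    Real.sqrt_mul (by positivity), Real.sqrt_sq (norm_nonneg _)]

theorem kern_ne_zero (h : IsDilation c p a b μ) {z : ℂ} (hz : z ∈ disk) : kern p z ≠ 0 :=
  HardyDisk.kern_ne_zero h.norm_p (mem_ball_zero_iff.1 hz).le

theorem norm_halfPlane_mob (h : IsDilation c p a b μ) {z : ℂ} (hz : z ∈ disk) :
    ‖halfPlane a b (mob c p z)‖ = μ * ‖halfPlane a b z‖ := by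
  rw [h.halfPlane_mob z hz, norm_mul, Complex.norm_real,
    Real.norm_of_nonneg (zero_lt_one.trans h.one_lt).le]

theorem norm_halfPlane_pos (h : IsDilation c p a b μ) {z : ℂ} (hz : z ∈ disk) :
    0 < ‖halfPlane a b z‖ := by
  refine norm_pos_iff.2 fun h0 => ?_
  have := re_halfPlane_pos h.norm_a h.norm_b h.ne hz
  simp [h0] at this

theorem norm_sub_pos (h : IsDilation c p a b μ) {z : ℂ} (hz : z ∈ disk) : 0 < ‖z - a‖ := by
  rw [← norm_one_sub_conj_mul h.norm_a]
  exact norm_pos_iff.2 (one_sub_conj_mul_ne_zero' h.norm_a hz)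

theorem norm_halfPlane_mul (h : IsDilation c p a b μ) {z : ℂ} (hz : z ∈ disk) :
    ‖halfPlane a b z‖ * ‖z - a‖ = ‖b - a‖ * ‖z - b‖ := by
  rw [norm_halfPlane h.norm_a h.norm_b, div_mul_cancel₀ _ (h.norm_sub_pos hz).ne']

theorem norm_halfPlane_mul_le (h : IsDilation c p a b μ) {z : ℂ} (hz : z ∈ disk) :
    ‖halfPlane a b z‖ * ‖z - a‖ ≤ 4 := by
  have hz' : ‖z‖ < 1 := mem_ball_zero_iff.1 hz
  have h1 := norm_sub_le b a
  have h2 := norm_sub_le z b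
  rw [h.norm_b, h.norm_a] at h1
  rw [h.norm_b] at h2
  rw [h.norm_halfPlane_mul hz]
  nlinarith [norm_nonneg (b - a), norm_nonneg (z - b)]

theorem exists_large_subset (h : IsDilation c p a b μ) {U : Set ℂ} (hU : U ∈ 𝓝[disk] a) :
    ∃ L : ℝ, ∀ z ∈ disk, L < ‖halfPlane a b z‖ → z ∈ U := by
  obtain ⟨ε, hε, hεU⟩ := Metric.mem_nhdsWithin_iff.1 hU
  refine ⟨4 / ε, fun z hz hL => hεU ⟨?_, hz⟩⟩
  rw [mem_ball, dist_eq_norm]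
  rw [div_lt_iff₀ hε] at hL
  have h1 := h.norm_halfPlane_mul_le hz
  have h2 := h.norm_halfPlane_pos hz
  by_contra! hle
  nlinarith

theorem exists_small_subset (h : IsDilation c p a b μ) {U : Set ℂ} (hU : U ∈ 𝓝[disk] b) :
    ∃ δ > 0, ∀ z ∈ disk, ‖halfPlane a b z‖ < δ → z ∈ U := by
  obtain ⟨ε, hε, hεU⟩ := Metric.mem_nhdsWithin_iff.1 hU
  have hba : 0 < ‖b - a‖ := norm_pos_iff.2 (sub_ne_zero.2 h.ne)
  refine ⟨ε * ‖b - a‖ / 2, by positivity, fun z hz hL => hεU ⟨?_, hz⟩⟩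
  rw [mem_ball, dist_eq_norm]
  have hz' : ‖z‖ < 1 := mem_ball_zero_iff.1 hz
  have h1 := norm_sub_le z a
  rw [h.norm_a] at h1
  have h2 := h.norm_halfPlane_mul hz
  have h3 := h.norm_halfPlane_pos hz
  have h4 : ‖b - a‖ * ‖z - b‖ < ‖b - a‖ * ε := by
    rw [← h2]
    nlinarith
  exact lt_of_mul_lt_mul_left h4 hba.le

theorem tendsto_iterate (h : IsDilation c p a b μ) {z : ℂ} (hz : z ∈ disk) :
    Tendsto (fun n => (mob c p)^[n] z) atTop (𝓝[disk] a) := by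
  have hmem : ∀ n, (mob c p)^[n] z ∈ disk := fun n => h.mapsTo.iterate n hz
  have hQ : ∀ n, ‖halfPlane a b ((mob c p)^[n] z)‖ = μ ^ n * ‖halfPlane a b z‖ := by
    intro n
    induction n with
    | zero => simp
    | succ n ih =>
      rw [Function.iterate_succ_apply', h.norm_halfPlane_mob (hmem n), ih, pow_succ]
      ring
  refine tendsto_def.2 fun U hU => ?_
  obtain ⟨L, hL⟩ := h.exists_large_subset hU
  have := (tendsto_pow_atTop_atTop_of_one_lt h.one_lt).atTop_mul_const (h.norm_halfPlane_pos hz)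
  filter_upwards [this.eventually_gt_atTop L] with n hn
  exact hL _ (hmem n) (by rwa [hQ])

theorem tendsto_iterate_inv (h : IsDilation c p a b μ) {z : ℂ} (hz : z ∈ disk) :
    Tendsto (fun n => (mobInv c p)^[n] z) atTop (𝓝[disk] b) := by
  have hmem : ∀ n, (mobInv c p)^[n] z ∈ disk := fun n => h.mapsTo_inv.iterate n hz
  have hμ : 0 < μ := zero_lt_one.trans h.one_lt
  have hQ : ∀ n, ‖halfPlane a b ((mobInv c p)^[n] z)‖ = μ⁻¹ ^ n * ‖halfPlane a b z‖ := by
    intro n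
    induction n with
    | zero => simp
    | succ n ih =>
      have h1 := h.norm_halfPlane_mob (h.mapsTo_inv (hmem n))
      rw [h.mob_inv (hmem n), ih] at h1
      rw [Function.iterate_succ_apply', pow_succ]
      rw [mul_right_comm, h1, mul_right_comm, mul_inv_cancel₀ hμ.ne', one_mul]
  refine tendsto_def.2 fun U hU => ?_
  obtain ⟨δ, hδ, hL⟩ := h.exists_small_subset hU
  have := (tendsto_pow_atTop_nhds_zero_of_lt_one (inv_nonneg.2 hμ.le)
    (inv_lt_one_of_one_lt₀ h.one_lt)).mul_const ‖halfPlane a b z‖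
  rw [zero_mul] at this
  filter_upwards [this.eventually_lt_const hδ] with n hn
  exact hL _ (hmem n) (by rwa [hQ])

/-- The bounded multipliers `Q ^ (i θ / log μ)`, with `Q` the half-plane coordinate, are
eigenfunctions of the composition with the dilation, for every eigenvalue on the unit circle. They
are the source of the circular symmetry of the spectrum. -/
theorem exists_twist (h : IsDilation c p a b μ) :
    ∃ K > 0, ∀ θ ∈ Icc 0 (2 * Real.pi), ∃ W : ℂ → ℂ, DifferentiableOn ℂ W disk ∧
      ∀ z ∈ disk, ‖W z‖ ≤ K ∧ 1 ≤ K * ‖W z‖ ∧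
        W (mob c p z) = Complex.exp (θ * Complex.I) * W z := by
  have hlog : 0 < Real.log μ := Real.log_pos h.one_lt
  have hμ : 0 < μ := zero_lt_one.trans h.one_lt
  have hpi := Real.pi_pos
  refine ⟨Real.exp (2 * Real.pi / Real.log μ * Real.pi), Real.exp_pos _, fun θ hθ =>
    ⟨fun z => Complex.exp (((θ / Real.log μ : ℝ) : ℂ) * Complex.I * Complex.log (halfPlane a b z)),
      ?_, fun z hz => ?_⟩⟩
  · have hlogd : DifferentiableOn ℂ (fun z => Complex.log (halfPlane a b z)) disk :=
      (differentiableOn_halfPlane h.norm_a).clog fun z hz =>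
        Or.inl (re_halfPlane_pos h.norm_a h.norm_b h.ne hz)
    exact (hlogd.const_mul _).cexp
  · have ht : 0 ≤ θ / Real.log μ := div_nonneg hθ.1 hlog.le
    have ht' : θ / Real.log μ ≤ 2 * Real.pi / Real.log μ := by
      gcongr
      exact hθ.2
    have hre : (((θ / Real.log μ : ℝ) : ℂ) * Complex.I * Complex.log (halfPlane a b z)).re
        = -(θ / Real.log μ * (halfPlane a b z).arg) := by
      rw [mul_assoc, Complex.re_ofReal_mul, Complex.I_mul_re, Complex.log_im]
      ring
    have habs : |θ / Real.log μ * (halfPlane a b z).arg| ≤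
        2 * Real.pi / Real.log μ * Real.pi := by
      rw [abs_mul, abs_of_nonneg ht]
      have := Complex.abs_arg_le_pi (halfPlane a b z)
      gcongr
    have := abs_le.1 habs
    refine ⟨?_, ?_, ?_⟩
    · rw [Complex.norm_exp, hre]
      exact Real.exp_le_exp.2 (by linarith)
    · rw [Complex.norm_exp, hre, ← Real.exp_add]
      exact Real.one_le_exp (by linarith)
    · have hne : halfPlane a b z ≠ 0 := norm_pos_iff.1 (h.norm_halfPlane_pos hz)
      have hlogC : ((Real.log μ : ℝ) : ℂ) ≠ 0 := by exact_mod_cast hlog.ne'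
      simp only
      rw [h.halfPlane_mob z hz, Complex.log_ofReal_mul hμ hne, ← Complex.exp_add]
      congr 1
      push_cast
      field_simp

end IsDilation

/-- Fourier coefficients are bounded by the supremum of the function. -/
theorem norm_coeff_le {x : ℕ → ℂ} (hx : Summable fun n => ‖x n‖) {C : ℝ}
    (h : ∀ θ ∈ Icc 0 (2 * Real.pi), ‖∑' n, x n * Complex.exp (θ * Complex.I) ^ n‖ ≤ C) (m : ℕ) :
    ‖x m‖ ≤ C := by
  have hpi := Real.pi_pos
  set F : ℕ → C(ℝ, ℂ) := fun n =>
    ⟨fun θ => x n * Complex.exp (((n : ℂ) - m) * Complex.I * θ), by fun_prop⟩ with hF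
  have hnorm : ∀ n θ, ‖F n θ‖ = ‖x n‖ := by
    intro n θ
    simp [hF, Complex.norm_exp]
  have hsum := intervalIntegral.hasSum_integral_of_dominated_convergence
    (μ := MeasureTheory.volume) (a := 0) (b := 2 * Real.pi) (F := fun n θ => F n θ)
    (f := fun θ => ∑' n, F n θ)
    (fun n _ => ‖x n‖) (fun n => (F n).continuous.aestronglyMeasurable)
    (fun n => Eventually.of_forall fun θ _ => (hnorm n θ).le)
    (Eventually.of_forall fun _ _ => hx) (by simp)
    (Eventually.of_forall fun θ _ => (Summable.of_norm (by simpa [hnorm] using hx)).hasSum)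
  have hcoef : ∀ n, n ≠ m → ∫ θ in (0 : ℝ)..2 * Real.pi, F n θ = 0 := by
    intro n hn
    have hne : ((n : ℂ) - m) * Complex.I ≠ 0 :=
      mul_ne_zero (sub_ne_zero.2 (by exact_mod_cast hn)) Complex.I_ne_zero
    simp only [hF, ContinuousMap.coe_mk]
    rw [intervalIntegral.integral_const_mul, integral_exp_mul_complex hne]
    have : ((n : ℂ) - m) * Complex.I * ((2 * Real.pi : ℝ) : ℂ)
        = ((n - m : ℤ) : ℂ) * (2 * Real.pi * Complex.I) := by
      push_cast
      ring
    rw [this, Complex.exp_int_mul_two_pi_mul_I]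
    simp
  have hm : ∫ θ in (0 : ℝ)..2 * Real.pi, F m θ = (2 * Real.pi : ℝ) * x m := by
    simp [hF]
  have heq := (hasSum_single m hcoef).unique hsum
  have hbound : ‖∫ θ in (0 : ℝ)..2 * Real.pi, ∑' n, F n θ‖ ≤ C * |2 * Real.pi - 0| := by
    refine intervalIntegral.norm_integral_le_of_norm_le_const fun θ hθ => ?_
    rw [uIoc_of_le (by positivity)] at hθ
    have : ∀ n, F n θ = Complex.exp (-(m * Complex.I * θ)) *
        (x n * Complex.exp (θ * Complex.I) ^ n) := by
      intro n
      simp only [hF, ContinuousMap.coe_mk]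
      rw [← Complex.exp_nat_mul, mul_left_comm, ← Complex.exp_add]
      congr 2
      ring
    simp only [this, tsum_mul_left, norm_mul]
    have h1 : ‖Complex.exp (-(m * Complex.I * θ))‖ = 1 := by simp [Complex.norm_exp]
    rw [h1, one_mul]
    exact h θ ⟨hθ.1.le, hθ.2⟩
  rw [← heq, hm, norm_mul, Complex.norm_real, Real.norm_of_nonneg (by positivity), sub_zero,
    abs_of_pos (by positivity), mul_comm] at hbound
  exact le_of_mul_le_mul_right hbound (by positivity)

end HardyDisk

namespace HardyDisk

/-! ### Weighted dilation operators: growth of powers -/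

/-- `T` is the operator `f ↦ Ψ · kern p · (f ∘ mob c p)`, a bounded multiple of the isometric
dilation `f ↦ kern p · (f ∘ mob c p)`, where `|Ψ| ≤ M` and `|Ψ|` has the limits `A` and `B` at the
attracting point `a` and at the repelling point `b`. -/
structure IsWeightedDilation (c p a b : ℂ) (μ : ℝ) (Ψ : ℂ → ℂ) (M A B : ℝ) (T : H2 →L[ℂ] H2) :
    Prop extends IsDilation c p a b μ where
  apply_eq : ∀ f : H2, ∀ z ∈ disk, T f z = Ψ z * (kern p z * f (mob c p z))
  bound : ∀ z ∈ disk, ‖Ψ z‖ ≤ M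
  tendsto_a : Tendsto (fun z => ‖Ψ z‖) (𝓝[disk] a) (𝓝 A)
  tendsto_b : Tendsto (fun z => ‖Ψ z‖) (𝓝[disk] b) (𝓝 B)

theorem sqrt_one_sub_pos {z : ℂ} (hz : z ∈ disk) : 0 < √(1 - ‖z‖ ^ 2) := by
  have : ‖z‖ < 1 := mem_ball_zero_iff.1 hz
  exact Real.sqrt_pos.2 (by nlinarith [norm_nonneg z])

/-- Point evaluation as a continuous linear functional on `H²`. -/
noncomputable def evalCLM (z : ℂ) (hz : z ∈ disk) : H2 →L[ℂ] ℂ :=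
  LinearMap.mkContinuous ⟨⟨fun f => f z, fun _ _ => rfl⟩, fun _ _ => rfl⟩ (√(1 - ‖z‖ ^ 2))⁻¹
    fun f => by
      rw [inv_mul_eq_div]
      exact norm_apply_le f hz

@[simp] theorem evalCLM_apply {z : ℂ} (hz : z ∈ disk) (f : H2) : evalCLM z hz f = f z := rfl

namespace IsWeightedDilation
variable {c p a b : ℂ} {μ : ℝ} {Ψ : ℂ → ℂ} {M A B : ℝ} {T : H2 →L[ℂ] H2}

theorem limit_a_nonneg (h : IsWeightedDilation c p a b μ Ψ M A B T) : 0 ≤ A :=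
  ge_of_tendsto' (h.tendsto_a.comp (h.tendsto_iterate (mem_ball_self one_pos)))
    fun _ => norm_nonneg _

theorem limit_b_nonneg (h : IsWeightedDilation c p a b μ Ψ M A B T) : 0 ≤ B :=
  ge_of_tendsto' (h.tendsto_b.comp (h.tendsto_iterate_inv (mem_ball_self one_pos)))
    fun _ => norm_nonneg _

theorem pow_succ_apply (h : IsWeightedDilation c p a b μ Ψ M A B T) (n : ℕ) (f : H2) {z : ℂ}
    (hz : z ∈ disk) :
    (T ^ (n + 1)) f z = Ψ z * (kern p z * (T ^ n) f (mob c p z)) := by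
  rw [pow_succ']
  exact h.apply_eq _ z hz

/-- A weight `v` with `|Ψ| v ≤ ρ (v ∘ mob c p)` controls the powers of `T`, because the powers of
the unweighted dilation are contractions. -/
theorem norm_pow_le (h : IsWeightedDilation c p a b μ Ψ M A B T) {v : ℂ → ℝ} {ρ v₀ : ℝ}
    (hρ : 0 ≤ ρ) (hv₀ : 0 < v₀) (hv : ∀ z ∈ disk, v₀ ≤ v z)
    (hΨ : ∀ z ∈ disk, ‖Ψ z‖ * v z ≤ ρ * v (mob c p z)) {f g : H2}
    (hfg : ∀ z ∈ disk, v z * ‖f z‖ ≤ ‖g z‖) (n : ℕ) :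
    ‖(T ^ n) f‖ ≤ v₀⁻¹ * ρ ^ n * ‖g‖ := by
  have key : ∀ n : ℕ, ∃ G : H2, ‖G‖ ≤ ‖g‖ ∧
      ∀ z ∈ disk, v z * ‖(T ^ n) f z‖ ≤ ρ ^ n * ‖G z‖ := by
    intro n
    induction n with
    | zero => exact ⟨g, le_rfl, by simpa using hfg⟩
    | succ n ih =>
      obtain ⟨G, hG, hGle⟩ := ih
      obtain ⟨G', hG', hn⟩ := exists_kern_mul_comp_mob h.norm_c h.norm_p G
      refine ⟨G', hn.trans (by rwa [one_mul]), fun z hz => ?_⟩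
      rw [h.pow_succ_apply n f hz, hG' z hz]
      simp only [norm_mul]
      calc v z * (‖Ψ z‖ * (‖kern p z‖ * ‖(T ^ n) f (mob c p z)‖))
          = (‖Ψ z‖ * v z) * (‖kern p z‖ * ‖(T ^ n) f (mob c p z)‖) := by ring
        _ ≤ (ρ * v (mob c p z)) * (‖kern p z‖ * ‖(T ^ n) f (mob c p z)‖) :=
          mul_le_mul_of_nonneg_right (hΨ z hz) (by positivity)
        _ = ρ * ‖kern p z‖ * (v (mob c p z) * ‖(T ^ n) f (mob c p z)‖) := by ring
        _ ≤ ρ * ‖kern p z‖ * (ρ ^ n * ‖G (mob c p z)‖) :=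
          mul_le_mul_of_nonneg_left (hGle _ (h.mapsTo hz)) (by positivity)
        _ = _ := by ring
  obtain ⟨G, hG, hGle⟩ := key n
  refine (H2.norm_le_of_pointwise (c := v₀⁻¹ * ρ ^ n) (by positivity) (g := G)
    fun z hz => ?_).trans (by gcongr)
  rw [mul_assoc, ← div_eq_inv_mul, le_div_iff₀ hv₀, mul_comm]
  exact (mul_le_mul_of_nonneg_right (hv z hz) (norm_nonneg _)).trans (hGle z hz)

theorem exists_pow_bound (h : IsWeightedDilation c p a b μ Ψ M A B T) {ρ : ℝ} (hρ : 0 < ρ) :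
    ∃ m : ℕ, M ≤ ρ * μ ^ m := by
  obtain ⟨m, hm⟩ := pow_unbounded_of_one_lt (M / ρ) h.one_lt
  refine ⟨m, ?_⟩
  rw [div_lt_iff₀ hρ] at hm
  linarith

theorem norm_pow_le_of_max_lt (h : IsWeightedDilation c p a b μ Ψ M A B T) {ρ : ℝ}
    (hρA : A < ρ) (hρB : B < ρ) : ∃ C, ∀ n : ℕ, ‖T ^ n‖ ≤ C * ρ ^ n := by
  have hρ : 0 < ρ := h.limit_a_nonneg.trans_lt hρA
  have hμ : 0 < μ := zero_lt_one.trans h.one_lt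
  obtain ⟨m, hm⟩ := h.exists_pow_bound hρ
  obtain ⟨δ, hδ, hb⟩ := h.exists_small_subset (h.tendsto_b.eventually_lt_const hρB)
  obtain ⟨L, ha⟩ := h.exists_large_subset (h.tendsto_a.eventually_lt_const hρA)
  -- the weight is the power of the modulus of the half-plane coordinate, truncated where `|Ψ| < ρ`
  set v : ℂ → ℝ := fun z => (max δ (min (μ * L) ‖halfPlane a b z‖)) ^ m with hv
  have hlow : ∀ z ∈ disk, δ ^ m ≤ v z := fun z _ => by
    simp only [hv]
    gcongr
    exact le_max_left _ _
  have hup : ∀ z ∈ disk, v z ≤ (max δ (μ * L)) ^ m := fun z _ => by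
    simp only [hv]
    gcongr
    exact min_le_left _ _
  have hmono : ∀ z ∈ disk, v z ≤ v (mob c p z) := fun z hz => by
    have := h.norm_halfPlane_mob hz
    simp only [hv]
    gcongr
    rw [this]
    have := h.norm_halfPlane_pos hz
    nlinarith [h.one_lt]
  have hΨ : ∀ z ∈ disk, ‖Ψ z‖ * v z ≤ ρ * v (mob c p z) := by
    intro z hz
    have hvz : 0 ≤ v z := by positivity
    have hsmall : ‖Ψ z‖ < ρ → ‖Ψ z‖ * v z ≤ ρ * v (mob c p z) := fun hlt =>
      mul_le_mul hlt.le (hmono z hz) hvz hρ.le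
    by_cases h1 : ‖halfPlane a b z‖ < δ
    · exact hsmall (hb z hz h1)
    by_cases h2 : L < ‖halfPlane a b z‖
    · exact hsmall (ha z hz h2)
    push Not at h1 h2
    have e1 : v z = ‖halfPlane a b z‖ ^ m := by
      have : ‖halfPlane a b z‖ ≤ μ * L := by nlinarith [h.one_lt]
      simp only [hv]
      rw [min_eq_right this, max_eq_right h1]
    have e2 : v (mob c p z) = μ ^ m * ‖halfPlane a b z‖ ^ m := by
      simp only [hv]
      rw [h.norm_halfPlane_mob hz, min_eq_right (by gcongr), max_eq_right, mul_pow]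
      nlinarith [h.one_lt]
    rw [e2, ← e1, ← mul_assoc]
    gcongr
    exact (h.bound z hz).trans hm
  refine ⟨(δ ^ m)⁻¹ * (max δ (μ * L)) ^ m, fun n => ?_⟩
  refine ContinuousLinearMap.opNorm_le_bound _ (by positivity) fun f => ?_
  have := h.norm_pow_le hρ.le (pow_pos hδ m) hlow hΨ (f := f)
    (g := (((max δ (μ * L)) ^ m : ℝ) : ℂ) • f) (fun z hz => ?_) n
  · refine this.trans_eq ?_
    rw [norm_smul, Complex.norm_real, Real.norm_of_nonneg (by positivity)]
    ring
  · rw [H2.smul_apply, norm_mul, Complex.norm_real, Real.norm_of_nonneg (by positivity)]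
    gcongr
    exact hup z hz

theorem norm_le_of_mem_spectrum (h : IsWeightedDilation c p a b μ Ψ M A B T) {l : ℂ}
    (hl : l ∈ spectrum ℂ T) : ‖l‖ ≤ max A B := by
  refine le_of_forall_gt_imp_ge_of_dense fun ρ hρ => ?_
  have hρA := (le_max_left A B).trans_lt hρ
  have hρ0 : 0 < ρ := h.limit_a_nonneg.trans_lt hρA
  obtain ⟨C, hC⟩ := h.norm_pow_le_of_max_lt hρA ((le_max_right A B).trans_lt hρ)
  by_contra! hlt
  obtain ⟨n, hn⟩ := pow_unbounded_of_one_lt (C * ‖(1 : H2 →L[ℂ] H2)‖)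
    ((one_lt_div hρ0).2 hlt)
  have h1 := spectrum.norm_le_norm_mul_of_mem (spectrum.pow_mem_pow T n hl)
  have h2 := mul_le_mul_of_nonneg_right (hC n) (norm_nonneg (1 : H2 →L[ℂ] H2))
  rw [norm_pow] at h1
  rw [div_pow, lt_div_iff₀ (by positivity)] at hn
  linarith [mul_right_comm C ‖(1 : H2 →L[ℂ] H2)‖ (ρ ^ n)]

/-! ### The disk of radius `B` -/

/-- The weights of the backward orbit series: `∏_{j=1}^{k} l / (Ψ · kern p)(z_{-j})`, where
`z_{-j}` is the `j`-th backward iterate of `z`. -/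
noncomputable def backwardWeight (c p : ℂ) (Ψ : ℂ → ℂ) (l z : ℂ) (k : ℕ) : ℂ :=
  ∏ j ∈ Finset.range k,
    l / (Ψ ((mobInv c p)^[j + 1] z) * kern p ((mobInv c p)^[j + 1] z))

/-- If `l - T` has a right inverse with `0 < |l| < B`, then `|Ψ|` is bounded below at the points
on whose strict backward orbit `Ψ` does not vanish. For `(l - T) f = g`, telescoping along the
backward orbit gives `-(Ψ · kern p)(z) f(z₁) = ∑ c_k g(z_{-k})`; twisting `g` isolates the term
`g(z)`. -/
theorem exists_one_le_mul_norm (h : IsWeightedDilation c p a b μ Ψ M A B T) {l : ℂ} (hl0 : l ≠ 0)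
    (hlB : ‖l‖ < B) {R : H2 →L[ℂ] H2} (hR : ∀ g, l • R g - T (R g) = g) :
    ∃ C, ∀ z ∈ disk, (∀ k : ℕ, Ψ ((mobInv c p)^[k + 1] z) ≠ 0) → 1 ≤ C * ‖Ψ z‖ := by
  obtain ⟨K, hK, htw⟩ := h.exists_twist
  refine ⟨K ^ 2 * ‖R‖, fun z hz hne => ?_⟩
  have hB : 0 < B := (norm_nonneg l).trans_lt hlB
  set y : ℕ → ℂ := fun k => (mobInv c p)^[k] z with hy
  have hmem : ∀ k, y k ∈ disk := fun k => h.mapsTo_inv.iterate k hz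
  have hmob : ∀ k, mob c p (y (k + 1)) = y k := fun k => by
    simp only [hy]
    rw [Function.iterate_succ_apply', h.mob_inv (hmem k)]
  set w := backwardWeight c p Ψ l z with hw
  have hw0 : w 0 = 1 := by simp [hw, backwardWeight]
  have hwne : ∀ k, Ψ (y (k + 1)) * kern p (y (k + 1)) ≠ 0 := fun k =>
    mul_ne_zero (hne k) (h.kern_ne_zero (hmem _))
  have hwsucc : ∀ k, w (k + 1) = w k * (l / (Ψ (y (k + 1)) * kern p (y (k + 1)))) := fun k => by
    simp only [hw, backwardWeight, Finset.prod_range_succ, hy]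
  set d : ℕ → ℝ := fun k => ‖w k‖ / √(1 - ‖y k‖ ^ 2) with hd
  have hwpos : ∀ k, w k ≠ 0 := by
    intro k
    induction k with
    | zero => simp [hw0]
    | succ k ih =>
      rw [hwsucc]
      exact mul_ne_zero ih (div_ne_zero hl0 (hwne k))
  have hdpos : ∀ k, 0 < d k := fun k =>
    div_pos (norm_pos_iff.2 (hwpos k)) (sqrt_one_sub_pos (hmem k))
  have hdsucc : ∀ k, d (k + 1) / d k = ‖l‖ / ‖Ψ (y (k + 1))‖ := by
    intro k
    have h1 := h.norm_kern_mul (hmem (k + 1))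
    rw [hmob] at h1
    have h2 := sqrt_one_sub_pos (hmem k)
    have h3 := sqrt_one_sub_pos (hmem (k + 1))
    have h4 := norm_pos_iff.2 (hwpos k)
    have h5 := norm_pos_iff.2 (hne k)
    have h6 := norm_pos_iff.2 (h.kern_ne_zero (hmem (k + 1)))
    have h7 : 0 < ‖Ψ (y (k + 1))‖ := h5
    simp only [hd, hwsucc, norm_mul, norm_div]
    rw [← h1]
    field_simp
  have hdsum : Summable d := by
    refine summable_of_ratio_test_tendsto_lt_one (l := ‖l‖ / B) ((div_lt_one hB).2 hlB)
      (Eventually.of_forall fun k => (hdpos k).ne') ?_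
    have := ((h.tendsto_b.comp (h.tendsto_iterate_inv hz)).comp (tendsto_add_atTop_nat 1))
    refine (tendsto_const_nhds.div this hB.ne').congr fun k => ?_
    rw [Real.norm_of_nonneg (hdpos _).le, Real.norm_of_nonneg (hdpos _).le, hdsucc]
    rfl
  have hbd : ∀ (f : H2) k, ‖w k * f (y k)‖ ≤ ‖f‖ * d k := by
    intro f k
    have := norm_apply_le f (hmem k)
    rw [norm_mul]
    calc ‖w k‖ * ‖f (y k)‖ ≤ ‖w k‖ * (‖f‖ / √(1 - ‖y k‖ ^ 2)) := by gcongr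
      _ = _ := by simp only [hd]; ring
  have hsum : ∀ f : H2, Summable fun k => ‖w k * f (y k)‖ := fun f =>
    Summable.of_nonneg_of_le (fun _ => norm_nonneg _) (hbd f) (hdsum.mul_left _)
  have hid : ∀ g : H2, ∑' k, w k * g (y k) = -(Ψ z * kern p z * R g (mob c p z)) := by
    intro g
    have hfin : ∀ n, ∑ k ∈ Finset.range (n + 1), w k * g (y k)
        = l * (w n * R g (y n)) - Ψ z * kern p z * R g (mob c p z) := by
      have hg : ∀ k, g (y k) = l * R g (y k) - Ψ (y k) * (kern p (y k) * R g (mob c p (y k))) := by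
        intro k
        rw [← h.apply_eq _ _ (hmem k), ← H2.smul_apply, ← H2.sub_apply, hR]
      intro n
      induction n with
      | zero =>
        rw [Finset.sum_range_one, hg 0, hw0]
        simp only [hy, Function.iterate_zero_apply]
        ring
      | succ n ih =>
        rw [Finset.sum_range_succ, ih, hg (n + 1), hmob]
        have : w (n + 1) * (Ψ (y (n + 1)) * kern p (y (n + 1))) = l * w n := by
          rw [hwsucc, mul_assoc, div_mul_cancel₀ _ (hwne n), mul_comm]
        linear_combination (-R g (y n)) * this
    have h1 := ((hsum g).of_norm.hasSum.tendsto_sum_nat).comp (tendsto_add_atTop_nat 1)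
    have h2 : Tendsto (fun n => l * (w n * R g (y n)) - Ψ z * kern p z * R g (mob c p z)) atTop
        (𝓝 (l * 0 - Ψ z * kern p z * R g (mob c p z))) :=
      (((hsum (R g)).of_norm.tendsto_atTop_zero).const_mul l).sub_const _
    rw [mul_zero, zero_sub] at h2
    exact tendsto_nhds_unique h1 (h2.congr fun n => (hfin n).symm)
  obtain ⟨g, hg1, hgz⟩ := exists_extremal hz
  have hez := sqrt_one_sub_pos hz
  have hcoef := norm_coeff_le (hsum g) (C := K ^ 2 * ‖R‖ * ‖Ψ z‖ / √(1 - ‖z‖ ^ 2)) ?_ 0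
  · rw [hw0, one_mul, le_div_iff₀ hez] at hcoef
    simp only [hy, Function.iterate_zero_apply] at hcoef
    rwa [hgz] at hcoef
  · intro θ hθ
    -- the backward orbit turns the twist by `2π - θ` into a rotation by `θ`
    obtain ⟨W, hWd, hW⟩ := htw (2 * Real.pi - θ) ⟨by linarith [hθ.2], by linarith [hθ.1]⟩
    obtain ⟨G, hG, hGn⟩ := exists_mul hWd hK.le (fun z hz => (hW z hz).1) g
    have hWy : ∀ k, W (y k) = Complex.exp (θ * Complex.I) ^ k * W z := by
      intro k
      induction k with
      | zero => simp [hy]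
      | succ k ih =>
        have h1 := (hW _ (hmem (k + 1))).2.2
        rw [hmob, ih] at h1
        have h2 : Complex.exp (θ * Complex.I) *
            Complex.exp (((2 * Real.pi - θ : ℝ) : ℂ) * Complex.I) = 1 := by
          rw [← Complex.exp_add, ← Complex.exp_two_pi_mul_I]
          congr 1
          push_cast
          ring
        rw [pow_succ, mul_right_comm, h1, mul_right_comm, mul_comm (Complex.exp _), h2, one_mul]
    have hz1 := h.mapsTo hz
    have e1 : ∑' k, w k * G (y k)
        = W z * ∑' k, w k * g (y k) * Complex.exp (θ * Complex.I) ^ k := by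
      rw [← tsum_mul_left]
      refine tsum_congr fun k => ?_
      rw [hG _ (hmem k), hWy]
      ring
    have e2 : ‖W z‖ * ‖∑' k, w k * g (y k) * Complex.exp (θ * Complex.I) ^ k‖
        = ‖Ψ z‖ * ‖kern p z‖ * ‖R G (mob c p z)‖ := by
      rw [← norm_mul, ← e1, hid, norm_neg, norm_mul, norm_mul]
    have h1 := norm_apply_le (R G) hz1
    have h2 : ‖R G‖ ≤ ‖R‖ * K := (R.le_opNorm G).trans (by
      gcongr
      exact hGn.trans (mul_le_of_le_one_right hK.le hg1))
    have h3 := h.norm_kern_mul hz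
    have h4 := sqrt_one_sub_pos hz1
    have h5 : ‖kern p z‖ * ‖R G (mob c p z)‖ ≤ ‖R‖ * K / √(1 - ‖z‖ ^ 2) := by
      rw [le_div_iff₀ hez, mul_right_comm, h3]
      rw [le_div_iff₀ h4] at h1
      linarith
    calc ‖∑' k, w k * g (y k) * Complex.exp (θ * Complex.I) ^ k‖
        ≤ (K * ‖W z‖) * ‖∑' k, w k * g (y k) * Complex.exp (θ * Complex.I) ^ k‖ :=
          le_mul_of_one_le_left (norm_nonneg _) (hW z hz).2.1
      _ = K * ‖Ψ z‖ * (‖kern p z‖ * ‖R G (mob c p z)‖) := by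
          rw [mul_assoc, e2]
          ring
      _ ≤ K * ‖Ψ z‖ * (‖R‖ * K / √(1 - ‖z‖ ^ 2)) := by gcongr
      _ = _ := by ring

theorem exists_lower_bound (h : IsWeightedDilation c p a b μ Ψ M A B T) {l : ℂ} (hl0 : l ≠ 0)
    (hlB : ‖l‖ < B) {R : H2 →L[ℂ] H2} (hR : ∀ g, l • R g - T (R g) = g) :
    ∃ C, ∀ z ∈ disk, 1 ≤ C * ‖Ψ z‖ := by
  classical
  obtain ⟨C, hC⟩ := h.exists_one_le_mul_norm hl0 hlB hR
  have hB : 0 < B := (norm_nonneg l).trans_lt hlB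
  have hne : ∀ z ∈ disk, Ψ z ≠ 0 := by
    intro z hz hz0
    have hev : ∃ N, ∀ k ≥ N, Ψ ((mobInv c p)^[k] z) ≠ 0 := by
      have := (h.tendsto_b.comp (h.tendsto_iterate_inv hz)).eventually_const_lt hB
      obtain ⟨N, hN⟩ := eventually_atTop.1 this
      exact ⟨N, fun k hk => norm_pos_iff.1 (hN k hk)⟩
    -- the last zero of `Ψ` on the backward orbit contradicts the lower bound there
    obtain ⟨n, hn⟩ : ∃ n, Nat.find hev = n + 1 := by
      refine Nat.exists_eq_succ_of_ne_zero fun h0 => ?_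
      exact Nat.find_spec hev 0 h0.le hz0
    have hzero : Ψ ((mobInv c p)^[n] z) = 0 := by
      by_contra hnz
      refine Nat.find_min hev (m := n) (by omega) fun k hk => ?_
      rcases hk.eq_or_lt with rfl | hlt
      · exact hnz
      · exact Nat.find_spec hev k (by omega)
    have := hC _ (h.mapsTo_inv.iterate n hz) fun k => by
      rw [← Function.iterate_add_apply]
      exact Nat.find_spec hev _ (by omega)
    rw [hzero, norm_zero, mul_zero] at this
    linarith
  exact ⟨C, fun z hz => hC z hz fun k => hne _ (h.mapsTo_inv.iterate (k + 1) hz)⟩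

/-- If the symbol is bounded below, `T` is invertible, with inverse the weighted composition
operator of the inverse automorphism. -/
theorem isUnit_of_lower_bound (h : IsWeightedDilation c p a b μ Ψ M A B T)
    (hΨ : DifferentiableOn ℂ Ψ disk) {C : ℝ} (hC : ∀ z ∈ disk, 1 ≤ C * ‖Ψ z‖) : IsUnit T := by
  have hC0 : 0 ≤ C := by
    by_contra! hneg
    have := hC 0 (mem_ball_self one_pos)
    nlinarith [norm_nonneg (Ψ 0)]
  have hΨne : ∀ z ∈ disk, Ψ z ≠ 0 := fun z hz h0 => by
    have := hC z hz
    rw [h0, norm_zero, mul_zero] at this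
    linarith
  set q := -(c * p) with hq
  set w : ℂ → ℂ := fun z =>
    (Ψ (mobInv c p z) * kern p (mobInv c p z) * kern q z)⁻¹ with hw
  have hk' : ∀ z ∈ disk, kern q z ≠ 0 := fun z hz =>
    HardyDisk.kern_ne_zero h.norm_mobInv_center (mem_ball_zero_iff.1 hz).le
  have hwd : DifferentiableOn ℂ w disk := by
    have h1 : DifferentiableOn ℂ (mobInv c p) disk := differentiableOn_mob h.norm_mobInv_center
    refine ((DifferentiableOn.mul (hΨ.comp h1 h.mapsTo_inv)
      ((differentiableOn_kern h.norm_p).comp h1 h.mapsTo_inv)).mul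
      (differentiableOn_kern h.norm_mobInv_center)).inv fun z hz => ?_
    exact mul_ne_zero (mul_ne_zero (hΨne _ (h.mapsTo_inv hz)) (h.kern_ne_zero (h.mapsTo_inv hz)))
      (hk' z hz)
  have hwb : ∀ z ∈ disk, ‖w z‖ ≤ C := by
    intro z hz
    have hz' := h.mapsTo_inv hz
    have h1 := h.norm_kern_mul hz'
    rw [h.mob_inv hz] at h1
    have h2 : ‖kern q z‖ * √(1 - ‖z‖ ^ 2) = √(1 - ‖mobInv c p z‖ ^ 2) := by
      rw [mobInv, ← norm_kern_sq_mul h.norm_conj_c h.norm_mobInv_center (mem_ball_zero_iff.1 hz).le,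
        Real.sqrt_mul (by positivity), Real.sqrt_sq (norm_nonneg _)]
    have h3 := sqrt_one_sub_pos hz
    have h4 : ‖kern p (mobInv c p z)‖ * ‖kern q z‖ = 1 := by
      apply mul_right_cancel₀ h3.ne'
      rw [mul_assoc, h2, h1, one_mul]
    have h5 := norm_pos_iff.2 (hΨne _ hz')
    simp only [hw]
    rw [norm_inv, norm_mul, norm_mul, mul_assoc, h4, mul_one]
    exact (inv_le_iff_one_le_mul₀ h5).2 (hC _ hz')
  obtain ⟨S, hS⟩ := exists_clm (w := fun z => w z * kern q z) (φ := mobInv c p) (C := C)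
    fun f => by
      obtain ⟨F, hF, hFn⟩ := exists_kern_mul_comp_mob h.norm_conj_c h.norm_mobInv_center f
      obtain ⟨G, hG, hGn⟩ := exists_mul hwd hC0 hwb F
      refine ⟨G, fun z hz => ?_, hGn.trans ?_⟩
      · rw [hG z hz, hF z hz, mul_assoc]
        rfl
      · rw [one_mul] at hFn
        gcongr
  have hST : S * T = 1 := by
    refine ContinuousLinearMap.ext fun f => H2.ext fun z hz => ?_
    have hz' := h.mapsTo_inv hz
    change S (T f) z = f z
    rw [(hS _).1 z hz, h.apply_eq f _ hz', h.mob_inv hz]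
    simp only [hw]
    have h1 := hΨne _ hz'
    have h2 := h.kern_ne_zero hz'
    have h3 := hk' z hz
    field_simp
  have hTS : T * S = 1 := by
    refine ContinuousLinearMap.ext fun f => H2.ext fun z hz => ?_
    have hz' := h.mapsTo hz
    change T (S f) z = f z
    rw [h.apply_eq _ z hz, (hS _).1 _ hz', h.inv_mob hz]
    simp only [hw]
    rw [h.inv_mob hz]
    have h1 := hΨne _ hz
    have h2 := h.kern_ne_zero hz
    have h3 := hk' _ hz'
    field_simp
  exact ⟨⟨T, S, hTS, hST⟩, rfl⟩

theorem mem_spectrum_of_norm_lt (h : IsWeightedDilation c p a b μ Ψ M A B T)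
    (hΨ : DifferentiableOn ℂ Ψ disk) (hT : ¬ IsUnit T) {l : ℂ} (hlB : ‖l‖ < B) :
    l ∈ spectrum ℂ T := by
  rcases eq_or_ne l 0 with rfl | hl0
  · rwa [spectrum.zero_mem_iff]
  rw [spectrum.mem_iff]
  rintro ⟨u, hu⟩
  obtain ⟨C, hC⟩ := h.exists_lower_bound hl0 hlB (R := ↑u⁻¹) fun g => by
    have : (u : H2 →L[ℂ] H2) ((↑u⁻¹ : H2 →L[ℂ] H2) g) = g := DFunLike.congr_fun u.mul_inv g
    rwa [hu, Algebra.algebraMap_eq_smul_one] at this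
  exact hT (h.isUnit_of_lower_bound hΨ hC)

end IsWeightedDilation

end HardyDisk

namespace HardyDisk
namespace IsWeightedDilation
variable {c p a b : ℂ} {μ : ℝ} {Ψ : ℂ → ℂ} {M A B : ℝ} {T : H2 →L[ℂ] H2}

/-! ### The annulus between `B` and `A` -/

/-- On functions vanishing to high order at the attracting point, the powers of `T` grow no faster
than at the repelling point. -/
theorem exists_norm_pow_le_of_vanishing (h : IsWeightedDilation c p a b μ Ψ M A B T) {ρ : ℝ}
    (hρB : B < ρ) : ∃ (m : ℕ) (C : ℝ), 0 ≤ C ∧ ∀ f g : H2,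
      (∀ z ∈ disk, ‖f z‖ ≤ ‖z - a‖ ^ m * ‖g z‖) → ∀ n : ℕ, ‖(T ^ n) f‖ ≤ C * ρ ^ n * ‖g‖ := by
  have hρ : 0 < ρ := h.limit_b_nonneg.trans_lt hρB
  have hμ : 0 < μ := zero_lt_one.trans h.one_lt
  obtain ⟨m, hm⟩ := h.exists_pow_bound hρ
  obtain ⟨δ, hδ, hb⟩ := h.exists_small_subset (h.tendsto_b.eventually_lt_const hρB)
  set v : ℂ → ℝ := fun z => (max δ ‖halfPlane a b z‖) ^ m with hv
  have hlow : ∀ z ∈ disk, δ ^ m ≤ v z := fun z _ => by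
    simp only [hv]
    gcongr
    exact le_max_left _ _
  have hΨ : ∀ z ∈ disk, ‖Ψ z‖ * v z ≤ ρ * v (mob c p z) := by
    intro z hz
    have hmob := h.norm_halfPlane_mob hz
    have hpos := h.norm_halfPlane_pos hz
    have hle : ‖halfPlane a b z‖ ≤ ‖halfPlane a b (mob c p z)‖ := by
      rw [hmob]
      nlinarith [h.one_lt]
    by_cases h1 : ‖halfPlane a b z‖ < δ
    · have : v z ≤ v (mob c p z) := by
        simp only [hv]
        gcongr
      exact mul_le_mul (hb z hz h1).le this (by positivity) hρ.le
    · push Not at h1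
      have e1 : v z = ‖halfPlane a b z‖ ^ m := by
        simp only [hv]
        rw [max_eq_right h1]
      have e2 : v (mob c p z) = μ ^ m * ‖halfPlane a b z‖ ^ m := by
        simp only [hv]
        rw [max_eq_right (h1.trans hle), hmob, mul_pow]
      rw [e1, e2, ← mul_assoc]
      gcongr
      exact (h.bound z hz).trans hm
  refine ⟨m, (δ ^ m)⁻¹ * (2 * δ + 4) ^ m, by positivity, fun f g hfg n => ?_⟩
  refine (h.norm_pow_le hρ.le (pow_pos hδ m) hlow hΨ (f := f)
    (g := (((2 * δ + 4) ^ m : ℝ) : ℂ) • g) (fun z hz => ?_) n).trans_eq ?_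
  · have hza : ‖z - a‖ ≤ 2 := by
      have h1 := norm_sub_le z a
      have h2 : ‖z‖ < 1 := mem_ball_zero_iff.1 hz
      rw [h.norm_a] at h1
      linarith
    have hle : max δ ‖halfPlane a b z‖ * ‖z - a‖ ≤ 2 * δ + 4 := by
      have h1 := h.norm_halfPlane_mul_le hz
      rw [max_mul_of_nonneg _ _ (norm_nonneg _)]
      refine max_le ?_ (by linarith)
      nlinarith
    rw [H2.smul_apply, norm_mul, Complex.norm_real, Real.norm_of_nonneg (by positivity)]
    calc v z * ‖f z‖ ≤ v z * (‖z - a‖ ^ m * ‖g z‖) :=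
          mul_le_mul_of_nonneg_left (hfg z hz) (by positivity)
      _ = (max δ ‖halfPlane a b z‖ * ‖z - a‖) ^ m * ‖g z‖ := by
          simp only [hv]
          ring
      _ ≤ _ := by gcongr
  · rw [norm_smul, Complex.norm_real, Real.norm_of_nonneg (by positivity)]
    ring

theorem pow_apply_mul (h : IsWeightedDilation c p a b μ Ψ M A B T) {w : ℂ → ℂ} {f g : H2}
    (hfg : ∀ z ∈ disk, f z = w z * g z) (n : ℕ) :
    ∀ z ∈ disk, (T ^ n) f z = w ((mob c p)^[n] z) * (T ^ n) g z := by
  induction n with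
  | zero => exact hfg
  | succ n ih =>
    intro z hz
    rw [h.pow_succ_apply n f hz, h.pow_succ_apply n g hz, ih _ (h.mapsTo hz),
      Function.iterate_succ_apply]
    ring

theorem norm_pow_apply_mul (h : IsWeightedDilation c p a b μ Ψ M A B T) (f : H2) (n : ℕ) :
    ∀ z ∈ disk, ‖(T ^ n) f z‖ * √(1 - ‖z‖ ^ 2) =
      (∏ k ∈ Finset.range n, ‖Ψ ((mob c p)^[k] z)‖) *
        (‖f ((mob c p)^[n] z)‖ * √(1 - ‖(mob c p)^[n] z‖ ^ 2)) := by
  induction n with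
  | zero => simp
  | succ n ih =>
    intro z hz
    have h1 := ih _ (h.mapsTo hz)
    rw [← h.norm_kern_mul hz] at h1
    rw [h.pow_succ_apply n f hz, Finset.prod_range_succ']
    simp only [Function.iterate_succ_apply, Function.iterate_zero_apply, norm_mul]
    calc _ = ‖Ψ z‖ * (‖(T ^ n) f (mob c p z)‖ * (‖kern p z‖ * √(1 - ‖z‖ ^ 2))) := by ring
      _ = _ := by
        rw [h1]
        ring

/-- On functions vanishing to high order at `a`, a left inverse of `l - T`, with `B < |l|`, is
given by the Neumann series. -/
theorem hasSum_resolvent {l : ℂ} {ρ : ℝ}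
    (hρ0 : 0 ≤ ρ) (hρl : ρ < ‖l‖) {R : H2 →L[ℂ] H2} (hR : ∀ f, R (l • f - T f) = f) {f : H2}
    {C : ℝ} (hf : ∀ n : ℕ, ‖(T ^ n) f‖ ≤ C * ρ ^ n) {z : ℂ} (hz : z ∈ disk) :
    Summable (fun n : ℕ => ‖(l⁻¹) ^ (n + 1) * (T ^ n) f z‖) ∧
      ∑' n : ℕ, (l⁻¹) ^ (n + 1) * (T ^ n) f z = R f z := by
  have hl : 0 < ‖l‖ := hρ0.trans_lt hρl
  have hl0 : l ≠ 0 := norm_pos_iff.1 hl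
  have hgeo : Summable fun n : ℕ => ‖l‖⁻¹ * C * (ρ / ‖l‖) ^ n :=
    (summable_geometric_of_lt_one (by positivity) ((div_lt_one hl).2 hρl)).mul_left _
  have hnorm : Summable fun n : ℕ => ‖(l⁻¹) ^ (n + 1) • (T ^ n) f‖ := by
    refine Summable.of_nonneg_of_le (fun _ => norm_nonneg _) (fun n => ?_) hgeo
    rw [norm_smul, norm_pow, norm_inv]
    calc ‖l‖⁻¹ ^ (n + 1) * ‖(T ^ n) f‖ ≤ ‖l‖⁻¹ ^ (n + 1) * (C * ρ ^ n) := by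
          gcongr
          exact hf n
      _ = _ := by
          rw [div_eq_mul_inv, mul_pow, pow_succ]
          ring
  have hs := hnorm.of_norm
  set S := ∑' n : ℕ, (l⁻¹) ^ (n + 1) • (T ^ n) f with hS
  have hlS : l • S - T S = f := by
    have h1 : T S = ∑' n : ℕ, (l⁻¹) ^ (n + 1) • (T ^ (n + 1)) f := by
      rw [hS, T.map_tsum hs]
      refine tsum_congr fun n => ?_
      rw [map_smul, pow_succ' T]
      rfl
    have h2 : l • S = ∑' n : ℕ, (l⁻¹) ^ n • (T ^ n) f := by
      rw [hS, ← tsum_const_smul'']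
      refine tsum_congr fun n => ?_
      rw [smul_smul, pow_succ', ← mul_assoc, mul_inv_cancel₀ hl0, one_mul]
    have hs2 : Summable fun n : ℕ => (l⁻¹) ^ n • (T ^ n) f := by
      refine (hs.const_smul l).congr fun n => ?_
      rw [smul_smul, pow_succ', ← mul_assoc, mul_inv_cancel₀ hl0, one_mul]
    rw [h2, h1, hs2.tsum_eq_zero_add, add_sub_cancel_right]
    simp
  have hRS : R f = S := by rw [← hR S, hlS]
  have hev : ∀ n : ℕ, evalCLM z hz ((l⁻¹) ^ (n + 1) • (T ^ n) f)
      = (l⁻¹) ^ (n + 1) * (T ^ n) f z := fun n => rfl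
  constructor
  · refine Summable.of_nonneg_of_le (fun _ => norm_nonneg _) (fun n => ?_)
      (hnorm.mul_left ‖evalCLM z hz‖)
    rw [← hev]
    exact (evalCLM z hz).le_opNorm _
  · rw [hRS, ← evalCLM_apply hz, hS, (evalCLM z hz).map_tsum hs]
    exact tsum_congr fun n => (hev n).symm

/-- If `l - T` were invertible with `B < |l|`, then the powers of `T` would grow at most like
`|l| ^ n`: the Neumann series, twisted, isolates each of its terms. -/
theorem exists_norm_pow_apply_le (h : IsWeightedDilation c p a b μ Ψ M A B T) {l : ℂ}
    (hlB : B < ‖l‖) {R : H2 →L[ℂ] H2} (hR : ∀ f, R (l • f - T f) = f) :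
    ∃ C, ∀ z ∈ disk, ∀ (g : H2) (n : ℕ),
      ‖(T ^ n) g z‖ * √(1 - ‖z‖ ^ 2) ≤ C * ‖l‖ ^ (n + 1) * ‖g‖ := by
  obtain ⟨ρ, hρB, hρl⟩ := exists_between hlB
  have hρ0 : 0 ≤ ρ := (h.limit_b_nonneg.trans_lt hρB).le
  have hl : 0 < ‖l‖ := hρ0.trans_lt hρl
  obtain ⟨m, C, hC, hgrow⟩ := h.exists_norm_pow_le_of_vanishing hρB
  obtain ⟨K, hK, htw⟩ := h.exists_twist
  have hvan : ∀ f g : H2, (∀ z ∈ disk, ‖f z‖ ≤ ‖z - a‖ ^ m * ‖g z‖) → ∀ z ∈ disk, ∀ n : ℕ,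
      ‖(T ^ n) f z‖ * √(1 - ‖z‖ ^ 2) ≤ K ^ 2 * ‖R‖ * ‖l‖ ^ (n + 1) * ‖f‖ := by
    intro f g hfg z hz n
    have hez := sqrt_one_sub_pos hz
    have hs := (hasSum_resolvent hρ0 hρl hR (f := f) (C := C * ‖g‖)
      (fun n => (hgrow f g hfg n).trans_eq (by ring)) hz).1
    have hcoef := norm_coeff_le hs (C := K ^ 2 * ‖R‖ * ‖f‖ / √(1 - ‖z‖ ^ 2)) ?_ n
    · rw [norm_mul, norm_pow, norm_inv, le_div_iff₀ hez, inv_pow, mul_assoc,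
        inv_mul_le_iff₀ (by positivity)] at hcoef
      linarith
    · intro θ hθ
      obtain ⟨W, hWd, hW⟩ := htw θ hθ
      obtain ⟨F, hF, hFn⟩ := exists_mul hWd hK.le (fun z hz => (hW z hz).1) f
      obtain ⟨-, hsum⟩ := hasSum_resolvent hρ0 hρl hR (f := F) (C := C * (K * ‖g‖))
        (fun n => (hgrow F ((K : ℂ) • g) (fun z hz => by
          rw [hF z hz, H2.smul_apply, norm_mul, norm_mul, Complex.norm_real,
            Real.norm_of_nonneg hK.le, mul_left_comm]
          exact mul_le_mul (hW z hz).1 (hfg z hz) (norm_nonneg _) hK.le) n).trans_eq (by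
            rw [norm_smul, Complex.norm_real, Real.norm_of_nonneg hK.le]
            ring)) hz
      have hWn : ∀ n : ℕ, W ((mob c p)^[n] z) = Complex.exp (θ * Complex.I) ^ n * W z := by
        intro n
        induction n with
        | zero => simp
        | succ n ih =>
          rw [Function.iterate_succ_apply', (hW _ (h.mapsTo.iterate n hz)).2.2, ih, pow_succ]
          ring
      have e1 : R F z = W z * ∑' n : ℕ, (l⁻¹) ^ (n + 1) * (T ^ n) f z *
          Complex.exp (θ * Complex.I) ^ n := by
        rw [← hsum, ← tsum_mul_left]
        refine tsum_congr fun n => ?_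
        rw [h.pow_apply_mul hF n z hz, hWn]
        ring
      have h1 := norm_apply_le (R F) hz
      have h2 : ‖R F‖ ≤ ‖R‖ * (K * ‖f‖) := (R.le_opNorm F).trans (by gcongr)
      refine (le_mul_of_one_le_left (norm_nonneg _) (hW z hz).2.1).trans ?_
      rw [mul_assoc, ← norm_mul, ← e1]
      calc K * ‖R F z‖ ≤ K * (‖R‖ * (K * ‖f‖) / √(1 - ‖z‖ ^ 2)) := by
            gcongr
            exact h1.trans (by gcongr)
        _ = _ := by ring
  refine ⟨K ^ 2 * ‖R‖, fun z hz g n => ?_⟩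
  set x := (mob c p)^[n] z with hx
  have hxm : x ∈ disk := h.mapsTo.iterate n hz
  -- multiplying by powers of `(a - z) / ((1 + ε) a - z)` makes `g` vanish at `a`, at no cost
  set s : ℝ → ℂ → ℂ := fun ε y => (1 - conj a * y) / (1 + ε - conj a * y) with hsdef
  have hre : ∀ y ∈ disk, (conj a * y).re < 1 := by
    intro y hy
    have hy' : ‖y‖ < 1 := mem_ball_zero_iff.1 hy
    refine (Complex.re_le_norm _).trans_lt ?_
    rwa [norm_mul, RCLike.norm_conj, h.norm_a, one_mul]
  have hden : ∀ ε : ℝ, 0 < ε → ∀ y ∈ disk, ε ≤ ‖1 + (ε : ℂ) - conj a * y‖ := by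
    intro ε hε y hy
    refine le_trans ?_ (Complex.re_le_norm _)
    have := hre y hy
    simp only [Complex.sub_re, Complex.add_re, Complex.one_re, Complex.ofReal_re]
    linarith
  have hs1 : ∀ ε : ℝ, 0 < ε → ∀ y ∈ disk, ‖s ε y‖ ≤ 1 := by
    intro ε hε y hy
    simp only [hsdef]
    rw [norm_div]
    refine div_le_one_of_le₀ (le_of_sq_le_sq ?_ (norm_nonneg _)) (norm_nonneg _)
    have := hre y hy
    simp only [← Complex.normSq_eq_norm_sq, Complex.normSq_apply, Complex.sub_re, Complex.sub_im,
      Complex.add_re, Complex.add_im, Complex.one_re, Complex.one_im, Complex.ofReal_re,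
      Complex.ofReal_im, add_zero]
    nlinarith
  have hbound : ∀ ε : ℝ, 0 < ε → ‖s ε x ^ m * (T ^ n) g z‖ * √(1 - ‖z‖ ^ 2) ≤
      K ^ 2 * ‖R‖ * ‖l‖ ^ (n + 1) * ‖g‖ := by
    intro ε hε
    have hsd : DifferentiableOn ℂ (fun y => s ε y ^ m) disk := by
      refine (DifferentiableOn.div (by fun_prop) (by fun_prop) fun y hy => ?_).pow m
      exact norm_pos_iff.1 (hε.trans_le (hden ε hε y hy))
    obtain ⟨F, hF, hFn⟩ := exists_mul hsd zero_le_one (fun y hy => by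
      rw [norm_pow]
      exact pow_le_one₀ (norm_nonneg _) (hs1 ε hε y hy)) g
    have h1 := hvan F ((((ε⁻¹) ^ m : ℝ) : ℂ) • g) (fun y hy => ?_) z hz n
    · rw [h.pow_apply_mul hF n z hz] at h1
      refine h1.trans ?_
      rw [one_mul] at hFn
      gcongr
    · rw [hF y hy, H2.smul_apply, norm_mul, norm_mul, Complex.norm_real,
        Real.norm_of_nonneg (by positivity), ← mul_assoc, ← mul_pow, norm_pow]
      gcongr
      simp only [hsdef]
      rw [norm_div, norm_one_sub_conj_mul h.norm_a, div_eq_mul_inv]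
      gcongr
      exact hden ε hε y hy
  have hlim : Tendsto (fun ε : ℝ => ‖s ε x ^ m * (T ^ n) g z‖ * √(1 - ‖z‖ ^ 2)) (𝓝[>] 0)
      (𝓝 (‖s 0 x ^ m * (T ^ n) g z‖ * √(1 - ‖z‖ ^ 2))) := by
    apply Tendsto.mono_left _ nhdsWithin_le_nhds
    apply ContinuousAt.tendsto
    have : 1 + ((0 : ℝ) : ℂ) - conj a * x ≠ 0 := by
      simpa using one_sub_conj_mul_ne_zero' h.norm_a hxm
    simp only [hsdef]
    fun_prop (disch := assumption)
  have hs0 : s 0 x = 1 := by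
    simp only [hsdef, Complex.ofReal_zero, add_zero]
    exact div_self (one_sub_conj_mul_ne_zero' h.norm_a hxm)
  rw [hs0, one_pow, one_mul] at hlim
  refine le_of_tendsto hlim ?_
  filter_upwards [self_mem_nhdsWithin] with ε hε using hbound ε hε

theorem mem_spectrum_of_norm_mem_Ioo (h : IsWeightedDilation c p a b μ Ψ M A B T) {l : ℂ}
    (hlB : B < ‖l‖) (hlA : ‖l‖ < A) : l ∈ spectrum ℂ T := by
  rw [spectrum.mem_iff]
  rintro ⟨u, hu⟩
  obtain ⟨C, hC⟩ := h.exists_norm_pow_apply_le hlB (R := ↑u⁻¹) fun f => by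
    have : (↑u⁻¹ : H2 →L[ℂ] H2) ((u : H2 →L[ℂ] H2) f) = f := DFunLike.congr_fun u.inv_mul f
    rwa [hu, Algebra.algebraMap_eq_smul_one] at this
  have hl : 0 < ‖l‖ := h.limit_b_nonneg.trans_lt hlB
  obtain ⟨ρ, hlρ, hρA⟩ := exists_between hlA
  have h0 : (0 : ℂ) ∈ disk := mem_ball_self one_pos
  obtain ⟨N, hN⟩ := eventually_atTop.1
    ((h.tendsto_a.comp (h.tendsto_iterate h0)).eventually_const_lt hρA)
  set z := (mob c p)^[N] 0 with hz
  have hzm : z ∈ disk := h.mapsTo.iterate N h0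
  have hΨ : ∀ k : ℕ, ρ ≤ ‖Ψ ((mob c p)^[k] z)‖ := fun k => by
    rw [hz, ← Function.iterate_add_apply]
    exact (hN (k + N) (by omega)).le
  have hρ0 : 0 < ρ := hl.trans hlρ
  have hC0 : 0 ≤ C := by
    obtain ⟨k, hk1, hk⟩ := exists_extremal h0
    have h1 := hC 0 h0 k 0
    rw [pow_zero, one_apply_eq_self, hk, zero_add, pow_one] at h1
    by_contra! hneg
    nlinarith [mul_nonneg hl.le (norm_nonneg k)]
  have hle : ∀ n : ℕ, ρ ^ n ≤ C * ‖l‖ ^ (n + 1) := by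
    intro n
    obtain ⟨k, hk1, hk⟩ := exists_extremal (h.mapsTo.iterate n hzm)
    have h1 := hC z hzm k n
    rw [h.norm_pow_apply_mul k n z hzm, hk, mul_one] at h1
    calc ρ ^ n = ∏ _k ∈ Finset.range n, ρ := by simp
      _ ≤ ∏ k ∈ Finset.range n, ‖Ψ ((mob c p)^[k] z)‖ :=
          Finset.prod_le_prod (fun _ _ => hρ0.le) fun k _ => hΨ k
      _ ≤ C * ‖l‖ ^ (n + 1) * ‖k‖ := h1
      _ ≤ C * ‖l‖ ^ (n + 1) := mul_le_of_le_one_right (by positivity) hk1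
  obtain ⟨n, hn⟩ := pow_unbounded_of_one_lt (C * ‖l‖) ((one_lt_div hl).2 hlρ)
  rw [div_pow, lt_div_iff₀ (by positivity)] at hn
  have := hle n
  rw [pow_succ] at this
  linarith [mul_right_comm C ‖l‖ (‖l‖ ^ n)]

/-! ### The spectrum -/

theorem spectrum_eq (h : IsWeightedDilation c p a b μ Ψ M A B T)
    (hΨ : DifferentiableOn ℂ Ψ disk) (hT : ¬ IsUnit T) :
    spectrum ℂ T = closedBall 0 (max A B) := by
  refine Subset.antisymm (fun l hl => mem_closedBall_zero_iff.2 (h.norm_le_of_mem_spectrum hl)) ?_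
  intro l hl
  rw [mem_closedBall_zero_iff] at hl
  rcases eq_or_ne l 0 with rfl | hl0
  · rwa [spectrum.zero_mem_iff]
  have hlpos : 0 < ‖l‖ := norm_pos_iff.2 hl0
  have hlim : Tendsto (fun t : ℝ => (t : ℂ) * l) (𝓝[<] 1) (𝓝 l) := by
    have : Tendsto (fun t : ℝ => (t : ℂ) * l) (𝓝 1) (𝓝 (((1 : ℝ) : ℂ) * l)) :=
      ContinuousAt.tendsto (by fun_prop)
    rw [Complex.ofReal_one, one_mul] at this
    exact this.mono_left nhdsWithin_le_nhds
  refine (spectrum.isClosed T).mem_of_tendsto hlim ?_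
  have hnorm : ∀ t : ℝ, 0 < t → ‖(t : ℂ) * l‖ = t * ‖l‖ := fun t ht => by
    rw [norm_mul, Complex.norm_real, Real.norm_of_nonneg ht.le]
  rcases le_or_gt ‖l‖ B with hlB | hlB
  · filter_upwards [Ioo_mem_nhdsLT zero_lt_one] with t ht
    refine h.mem_spectrum_of_norm_lt hΨ hT ?_
    rw [hnorm t ht.1]
    nlinarith [ht.2]
  · have hlA : ‖l‖ ≤ A := (le_max_iff.1 hl).resolve_right (not_le.2 hlB)
    have h1 : max 0 (B / ‖l‖) < 1 := max_lt one_pos ((div_lt_one hlpos).2 hlB)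
    filter_upwards [Ioo_mem_nhdsLT h1] with t ht
    have ht0 : 0 < t := (le_max_left _ _).trans_lt ht.1
    refine h.mem_spectrum_of_norm_mem_Ioo ?_ ?_
    · rw [hnorm t ht0, ← div_lt_iff₀ hlpos]
      exact (le_max_right _ _).trans_lt ht.1
    · rw [hnorm t ht0]
      nlinarith [ht.2]

end IsWeightedDilation

end HardyDisk

open HardyDisk

theorem theorem3p7 (φ ψ : ℂ → ℂ) (a b : ℂ)
    (hφ : HardyDisk.IsHyperbolic φ)
    (ha : HardyDisk.IsDenjoyWolffPoint φ a)
    (hb : b ∈ HardyDisk.boundaryFixedPoints φ) (hab : b ≠ a)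
    (hψ : HardyDisk.IsHInfty ψ)
    (hψa : ContinuousWithinAt ψ HardyDisk.disk a)
    (hψb : ContinuousWithinAt ψ HardyDisk.disk b) :
    ∃ da db : ℝ, 0 < da ∧ 0 < db ∧
      HasDerivWithinAt (HardyDisk.boundaryExt φ) (da : ℂ) (closedBall 0 1) a ∧
      HasDerivWithinAt (HardyDisk.boundaryExt φ) (db : ℂ) (closedBall 0 1) b ∧
      (∃ T : HardyDisk.H2 →L[ℂ] HardyDisk.H2, HardyDisk.IsWeightedComposition ψ φ T) ∧
      ∀ T : HardyDisk.H2 →L[ℂ] HardyDisk.H2, HardyDisk.IsWeightedComposition ψ φ T →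
        ¬ IsUnit T →
          spectrum ℂ T = closedBall (0 : ℂ)
            (max (‖ψ a‖ * da ^ (-(1 / 2) : ℝ)) (‖ψ b‖ * db ^ (-(1 / 2) : ℝ))) := by
  obtain ⟨c, p, hc, hp, heq⟩ := hφ.1.exists_mob
  have ha1 : ‖a‖ = 1 := mem_sphere_zero_iff_norm.1 ha.1.1
  have hb1 : ‖b‖ = 1 := mem_sphere_zero_iff_norm.1 hb.1
  have hfa : mob c p a = a := by
    rw [← boundaryExt_eq hp heq (mem_closedBall_zero_iff.2 ha1.le)]
    exact ha.1.2
  have hfb : mob c p b = b := by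
    rw [← boundaryExt_eq hp heq (mem_closedBall_zero_iff.2 hb1.le)]
    exact hb.2
  have hconj := (halfPlane_mob hp ha1 hb1 hab hfa hfb).2
  have hdil : IsDilation c p a b (‖kern p b‖ ^ 2) := by
    refine ⟨hc, hp, ha1, hb1, hab, ?_, hconj⟩
    refine one_lt_of_denjoyWolff (by positivity) hφ.1.2.mapsTo ha1 hb1 hab (fun z hz => ?_) ha
    rw [heq hz]
    exact hconj z hz
  have hka := norm_pos_iff.2 (kern_ne_zero hp ha1.le)
  have hkb := norm_pos_iff.2 (kern_ne_zero hp hb1.le)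
  obtain ⟨M, hM⟩ := hψ.2
  have hM0 : 0 ≤ M := (norm_nonneg _).trans (hM 0 (mem_ball_self one_pos))
  set Ψ : ℂ → ℂ := fun z => ψ z / kern p z with hΨdef
  have hΨd : DifferentiableOn ℂ Ψ disk :=
    hψ.1.div (differentiableOn_kern hp) fun z hz => hdil.kern_ne_zero hz
  have hp1 : 0 < √(1 - ‖p‖ ^ 2) := sqrt_one_sub_pos (mem_ball_zero_iff.2 hp)
  have hΨM : ∀ z ∈ disk, ‖Ψ z‖ ≤ M * (2 / √(1 - ‖p‖ ^ 2)) := by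
    intro z hz
    have hz' : ‖z‖ < 1 := mem_ball_zero_iff.1 hz
    have h1 : ‖1 - conj p * z‖ ≤ 2 := by
      refine (norm_sub_le _ _).trans ?_
      rw [norm_one, norm_mul, RCLike.norm_conj]
      nlinarith [norm_nonneg p, norm_nonneg z]
    simp only [hΨdef, kern]
    rw [div_div_eq_mul_div, mul_div_assoc, norm_mul, norm_div, Complex.norm_real,
      Real.norm_of_nonneg hp1.le]
    gcongr
    exact hM z hz
  have hmul : ∀ z ∈ disk, ∀ x : ℂ, Ψ z * (kern p z * x) = ψ z * x := by
    intro z hz x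
    simp only [hΨdef]
    rw [← mul_assoc, div_mul_cancel₀ _ (hdil.kern_ne_zero hz)]
  have hlim : ∀ x : ℂ, ‖x‖ = 1 → ContinuousWithinAt ψ disk x →
      Tendsto (fun z => ‖Ψ z‖) (𝓝[disk] x) (𝓝 (‖ψ x‖ * (‖kern p x‖ ^ 2) ^ (-(1 / 2) : ℝ))) := by
    intro x hx hψx
    have hk : ContinuousWithinAt (kern p) disk x := by
      have := one_sub_conj_mul_ne_zero hp hx.le
      unfold kern
      exact ContinuousAt.continuousWithinAt (by fun_prop (disch := assumption))
    have hkx := kern_ne_zero hp hx.le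
    have h1 := (hψx.tendsto.div hk.tendsto hkx).norm
    have h2 : (‖kern p x‖ ^ 2) ^ (-(1 / 2) : ℝ) = ‖kern p x‖⁻¹ := by
      rw [← Real.rpow_natCast, ← Real.rpow_mul (norm_nonneg _)]
      norm_num
      exact Real.rpow_neg_one _
    rw [h2, ← div_eq_mul_inv, ← norm_div]
    exact h1
  refine ⟨‖kern p a‖ ^ 2, ‖kern p b‖ ^ 2, by positivity, by positivity,
    hasDerivWithinAt_boundaryExt hp heq ha1 hfa, hasDerivWithinAt_boundaryExt hp heq hb1 hfb,
    ?_, ?_⟩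
  · obtain ⟨T, hT⟩ := exists_clm (w := ψ) (φ := φ) (C := M * (2 / √(1 - ‖p‖ ^ 2))) fun f => by
      obtain ⟨F, hF, hFn⟩ := exists_kern_mul_comp_mob hc hp f
      obtain ⟨G, hG, hGn⟩ := exists_mul hΨd (by positivity) hΨM F
      refine ⟨G, fun z hz => ?_, hGn.trans ?_⟩
      · rw [hG z hz, hF z hz, hmul z hz, heq hz]
      · rw [one_mul] at hFn
        gcongr
    exact ⟨T, fun f => (hT f).1⟩
  · intro T hT hunit
    refine IsWeightedDilation.spectrum_eq (Ψ := Ψ) ⟨hdil, fun f z hz => ?_, hΨM, hlim a ha1 hψa,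
      hlim b hb1 hψb⟩ hΨd hunit
    rw [hT f z hz, hmul z hz, heq hz]
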